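/- Let $I\subseteq \mathbb{Q}[x_1,\dots,x_n]$ be an ideal, let $X\subseteq\mathbb{C}^n$ be the scheme defined by $I$, and let $\mu\ge 0$ be an integer. Let $K_{i_1},\dots,K_{i_m}\subseteq\mathbb{C}[x_1,\dots,x_n]$, $i_1>\dots>i_m$, be ideals giving an equidimensional decomposition of $X_{\mathrm{red}}$: the zero set of $K_{i_j}$ is the union of all irreducible components of $X_{\mathrm{red}}$ of dimension $i_j$, and $X_{\mathrm{red}}$ is the union of these zero sets. Fix finite generating systems $K_{i_j}=\langle g_{j,1},\dots,g_{j,r_j}\rangle$, and let $\nu$ be the number of indices $j$ with $i_j>\mu$. For complex numbers $a_{l,0},\dots,a_{l,n}$ ($1\le l\le \mu$) and $\lambda_{j,s}$ ($1\le j\le\nu$, $1\le s\le r_j$) put $$L_l=a_{l,0}+a_{l,1}x_1+\dots+a_{l,n}x_n,\qquad P_j=1-T_j\sum_{s=1}^{r_j}\lambda_{j,s}\,g_{j,s},$$ $$\mathfrak{J}(\mu)=I+\langle L_1,\dots,L_\mu\rangle+\langle P_1,\dots,P_\nu\rangle\subseteq\mathbb{C}[x_1,\dots,x_n,T_1,\dots,T_\nu].$$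 Let $\mathfrak{I}_\mu\subseteq\mathbb{Q}[x_1,\dots,x_n]$ be the intersection of all $\mu$-dimensional isolated primary components of $I$, that is, of those members $\mathfrak{q}$ of a primary decomposition of $I$ for which $\sqrt{\mathfrak{q}}$ is a minimal prime over $I$ and $\dim \mathbb{Q}[x_1,\dots,x_n]/\mathfrak{q}=\mu$ (the empty intersection is the unit ideal). For an ideal $J\subseteq\mathbb{Q}[x_1,\dots,x_n]$ with $\dim\mathbb{Q}[x_1,\dots,x_n]/J=d$ let $\deg(J)$ be $d!$ times the coefficient of $t^d$ in its affine Hilbert polynomial, i.e. $\deg(J)=\lim_{t\to\infty} d!\,t^{-d}\dim_{\mathbb{Q}}\big(\mathbb{Q}[x]_{\le t}/J_{\le t}\big)$, where the subscript $\le t$ denotes the polynomials of total degree at most $t$; the unit ideal has degree $0$. Then for generic $(a,\lambda)$, i.e. for all $(a,\lambda)$ outside the zero set of some nonzero polynomial in these parameters, the vector space $\mathbb{C}[x_1,\dots,x_n,T_1,\dots,T_\nu]/\mathfrak{J}(\mu)$ is finite-dimensional, and its dimension $\deg_\mu(I)$ satisfies $$\deg_\mu(I)=\dim_{\mathbb{C}}\mathbb{C}[x_1,\dots,x_n,T_1,\dots,T_\nu]/\mathfrak{J}(\mu)=\deg(\mathfrak{I}_\mu).$$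 -/

import Mathlib

open MvPolynomial

noncomputable section

/-- A property `P` of points of the affine space `k^τ` holds for generic points: it holds on the
complement of the hypersurface cut out by some nonzero polynomial (for finite `τ` and infinite `k`:
`P` holds on a nonempty Zariski open set). -/
def HoldsGenerically {k τ : Type*} [Field k] (P : (τ → k) → Prop) : Prop :=
  ∃ Φ : MvPolynomial τ k, Φ ≠ 0 ∧ ∀ c : τ → k, eval c Φ ≠ 0 → P c

/-- The affine Hilbert function of `J`: the dimension of `k[x]_{≤ t} / J_{≤ t}`, that is, of the
image of the space of polynomials of total degree at most `t` in `k[x] / J`. -/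
def affineHilbertFunction {σ k : Type*} [Field k] (J : Ideal (MvPolynomial σ k)) (t : ℕ) : ℕ :=
  Module.finrank k
    ((restrictTotalDegree σ k t).map (Ideal.Quotient.mkₐ k J).toLinearMap)

/-- The dimension of `k[x] / J` as a natural number (`0` for the unit ideal). -/
def affineDim {σ k : Type*} [Field k] (J : Ideal (MvPolynomial σ k)) : ℕ :=
  ((ringKrullDim (MvPolynomial σ k ⧸ J)).unbotD 0).toNat

/-- The degree of the ideal `J` (of the affine scheme defined by `J`, equivalently of its
projective closure): `d !` times the coefficient of `t ^ d` in the affine Hilbert polynomial of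
`J`, where `d` is the dimension of `J`. As the Hilbert function agrees with a polynomial of degree
`d` for large `t`, this is the limit of `d ! * HF_J(t) / t ^ d`. The unit ideal has degree `0`. -/
def affineDegree {σ k : Type*} [Field k] (J : Ideal (MvPolynomial σ k)) : ℝ :=
  Filter.limUnder Filter.atTop fun t : ℕ =>
    ((affineDim J).factorial : ℝ) * (affineHilbertFunction J t : ℝ) / (t : ℝ) ^ affineDim J

/-- `t` is a primary decomposition of the ideal `I`. -/
structure IsPrimaryDecomp {R : Type*} [CommRing R] (I : Ideal R) (t : Finset (Ideal R)) :
    Prop where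
  primary : ∀ q ∈ t, q.IsPrimary
  inf_eq : t.inf id = I

/-- The intersection of all isolated primary components of dimension `μ` of `I`, with respect to
the primary decomposition `t` of `I`; a component is isolated if its radical is a minimal prime of
`I`. The empty intersection is the unit ideal. -/
def isolatedPart {R : Type*} [CommRing R] (I : Ideal R) (t : Finset (Ideal R)) (μ : ℕ) : Ideal R :=
  sInf {q | q ∈ t ∧ q.radical ∈ I.minimalPrimes ∧ ringKrullDim (R ⧸ q) = (μ : WithBot ℕ∞)}

/-- The union of all irreducible components of dimension `i` of the zero set of `I`. -/
def componentsOfDim {k : Type*} [Field k] {n : ℕ} (I : Ideal (MvPolynomial (Fin n) k)) (i : ℕ) :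
    Set (Fin n → k) :=
  {x | ∃ p ∈ I.minimalPrimes,
    ringKrullDim (MvPolynomial (Fin n) k ⧸ p) = (i : WithBot ℕ∞) ∧ x ∈ zeroLocus k p}

/-- Ideals `K 0, …, K (m - 1)` giving an equidimensional decomposition of the variety defined by
`I`: the zero set of `K j` is the union of all irreducible components of dimension `dim j`, the
dimensions `dim j` are strictly decreasing, and these zero sets cover the zero set of `I`. -/
structure EquidimDecomp {k : Type*} [Field k] {n : ℕ} (I : Ideal (MvPolynomial (Fin n) k)) where
  m : ℕ
  dim : Fin m → ℕ
  dim_anti : StrictAnti dim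
  K : Fin m → Ideal (MvPolynomial (Fin n) k)
  zeroLocus_K : ∀ j, zeroLocus k (K j) = componentsOfDim I (dim j)
  zeroLocus_eq : zeroLocus k I = ⋃ j, zeroLocus k (K j)

/-- The indices of the pieces of dimension larger than `μ`; they also index the extra variables. -/
abbrev EquidimDecomp.Above {k : Type*} [Field k] {n : ℕ} {I : Ideal (MvPolynomial (Fin n) k)}
    (D : EquidimDecomp I) (μ : ℕ) : Type :=
  {j : Fin D.m // μ < D.dim j}

/-- The index set of the coefficients that are to be chosen generically: for each of the `μ` affine
linear forms its `n + 1` coefficients (`none` for the constant term), and for each piece `j` of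
dimension larger than `μ` one coefficient for each of the `r j` generators of `K j`. -/
abbrev ParamIndex {k : Type*} [Field k] {n : ℕ} {I : Ideal (MvPolynomial (Fin n) k)}
    (D : EquidimDecomp I) (r : Fin D.m → ℕ) (μ : ℕ) : Type :=
  (Fin μ × Option (Fin n)) ⊕ (Σ j : D.Above μ, Fin (r j.1))

/-- The affine linear form `a₀ + a₁ x₁ + ⋯ + aₙ xₙ`. -/
def affineForm {k : Type*} [Field k] {n : ℕ} (a : Option (Fin n) → k) : MvPolynomial (Fin n) k :=
  C (a none) + ∑ i, C (a (some i)) * X i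

/-- The ideal `𝔍(μ) = I + ⟨L_1, …, L_μ⟩ + ⟨1 - T_j * ∑ λ_{j,s} g_{j,s} : dim j > μ⟩` of
`k[x_1, …, x_n, (T_j)_j]`, for the coefficients `c` of the `L_i` and the `λ_{j,s}`. -/
def sectionIdeal {k : Type*} [Field k] {n : ℕ} {I : Ideal (MvPolynomial (Fin n) k)}
    (D : EquidimDecomp I) (r : Fin D.m → ℕ) (g : ∀ j, Fin (r j) → MvPolynomial (Fin n) k) (μ : ℕ)
    (c : ParamIndex D r μ → k) : Ideal (MvPolynomial (Fin n ⊕ D.Above μ) k) :=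
  I.map (rename (Sum.inl : Fin n → Fin n ⊕ D.Above μ)) ⊔
  Ideal.span (Set.range fun l : Fin μ =>
    rename (Sum.inl : Fin n → Fin n ⊕ D.Above μ) (affineForm fun o => c (Sum.inl (l, o)))) ⊔
  Ideal.span (Set.range fun j : D.Above μ =>
    1 - X (Sum.inr j) * rename (Sum.inl : Fin n → Fin n ⊕ D.Above μ)
      (∑ s : Fin (r j.1), C (c (Sum.inr ⟨j, s⟩)) * g j.1 s))

end

noncomputable section

/-! Everything is computed at the generic parameter value and then specialized. Let `k` be the field
of definition and `E` the algebraically closed field. Adjoin to `E` independent transcendentals for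
all parameters except the constant terms of the `L_l`. This gives `K`; the constant terms become
coordinates `Y_l` of μ-space. Put `y_l = -∑ a_{l,i} x_i` and `h_j = ∑ λ_{j,s} g_{j,s}`. Then `L_l =
0` reads `Y_l = y_l`, so the generic section is the generic fibre, over `F = K(Y)`, of the map `y`
on the open set where all `h_j` are invertible.

Over `F` every nonzero polynomial in the `y_l` is a unit. A primary component of dimension below μ
contains such a polynomial. A component of larger dimension, or one of dimension μ embedded in a
larger one, lies in a piece `K j` with `dim j > μ` and so contains a power of `∏ h_j`. Only the
isolated part of dimension μ survives (`exists_aeval_mul_mem`). Conversely `h_j` vanishes on that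
part only over a hypersurface of μ-space, so inverting it costs nothing there
(`exists_aeval_mem_sup_span`). Hence the section algebra is `F ⊗_{K[Y]} A`, where `A` is the
coordinate ring over `K` of the isolated part (`nonempty_algEquiv_sectionIdealOf`).

Its dimension is the rank of `A` over `K[Y]`, and this rank is the degree. Indeed μ generic linear
forms have no common zero at infinity on a scheme of dimension at most μ; a point there is a prime
of a Rees algebra (`exists_pow_mem_or_exists_field`), and counting parameters excludes it
(`false_of_generic_relation`). So `A` is finite over `K[Y]` with control of degrees, and its Hilbert
function grows like rank times `t^μ / μ!` (`tendsto_finrank_pow`). Extending the field does not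
change Hilbert functions.

Finally, the section algebra over the ring of all parameters becomes free after inverting one
nonzero polynomial, so outside its zero set every fibre has the dimension of the generic one
(`exists_ne_zero_forall_finrank_tensor`). -/

/-- The span of `1` and of the members of the family `v`. -/
def linSpan (k : Type*) {σ B : Type*} [CommSemiring k] [Semiring B] [Algebra k B] (v : σ → B) :
    Submodule k B :=
  Submodule.span k (insert 1 (Set.range v))

/-! ### Filtration by degree as powers of a subspace -/

section Filtration

variable {k σ B : Type*} [Field k] [CommRing B] [Algebra k B]

lemma one_le_linSpan (v : σ → B) : 1 ≤ linSpan k v := by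
  rw [Submodule.one_le]
  exact Submodule.subset_span (Set.mem_insert _ _)

lemma mem_linSpan (v : σ → B) (i : σ) : v i ∈ linSpan k v :=
  Submodule.subset_span (Set.mem_insert_of_mem _ (Set.mem_range_self i))

lemma linSpan_le {v : σ → B} {M : Submodule k B} (h1 : 1 ∈ M) (hv : ∀ i, v i ∈ M) :
    linSpan k v ≤ M := by
  refine Submodule.span_le.2 ?_
  rintro x (rfl | ⟨i, rfl⟩)
  exacts [h1, hv i]

lemma map_linSpan {B' : Type*} [CommRing B'] [Algebra k B'] (f : B →ₐ[k] B') (v : σ → B) :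
    (linSpan k v).map f.toLinearMap = linSpan k (fun i => f (v i)) := by
  rw [linSpan, linSpan, Submodule.map_span, Set.image_insert_eq, ← Set.range_comp]
  simp [Function.comp_def]

instance [Finite σ] (v : σ → B) : Module.Finite k (linSpan k v) :=
  Module.Finite.span_of_finite k ((Set.finite_range v).insert 1)

instance finite_pow_submodule (V : Submodule k B) [Module.Finite k V] (t : ℕ) :
    Module.Finite k (V ^ t : Submodule k B) := by
  have hV : V.FG := Module.Finite.iff_fg.1 inferInstance
  exact Module.Finite.iff_fg.2 (hV.pow t)

instance finite_mul_submodule (V W : Submodule k B) [Module.Finite k V] [Module.Finite k W] :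
    Module.Finite k (V * W : Submodule k B) := by
  have hV : V.FG := Module.Finite.iff_fg.1 inferInstance
  have hW : W.FG := Module.Finite.iff_fg.1 inferInstance
  exact Module.Finite.iff_fg.2 (hV.mul hW)

lemma linSpan_pow_mono (v : σ → B) : Monotone fun t => linSpan k v ^ t :=
  fun _ _ h => pow_le_pow_right₀ (one_le_linSpan v) h

lemma Submodule.finrank_mul_le (M N : Submodule k B) [Module.Finite k M] [Module.Finite k N] :
    Module.finrank k (M * N : Submodule k B) ≤ Module.finrank k M * Module.finrank k N := by
  rw [← Submodule.mulMap_range, ← Module.finrank_tensorProduct]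
  exact LinearMap.finrank_range_le _

lemma prod_mem_prod_submodule {ι : Type*} {s : Finset ι} {M : ι → Submodule k B} {x : ι → B}
    (h : ∀ i ∈ s, x i ∈ M i) : ∏ i ∈ s, x i ∈ ∏ i ∈ s, M i := by
  classical
  induction s using Finset.induction_on with
  | empty => simp only [Finset.prod_empty]; exact Submodule.one_le.1 le_rfl
  | insert a s ha ih =>
    rw [Finset.prod_insert ha, Finset.prod_insert ha]
    exact Submodule.mul_mem_mul (h a (Finset.mem_insert_self _ _))
      (ih fun i hi => h i (Finset.mem_insert_of_mem hi))

/-- This turns degree bounds into products of subspaces, which make sense in every quotient and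
allow comparing filtrations with different generators. -/
lemma restrictTotalDegree_eq_linSpan_pow (t : ℕ) :
    restrictTotalDegree σ k t = linSpan k (X : σ → MvPolynomial σ k) ^ t := by
  apply le_antisymm
  · intro p hp
    rw [mem_restrictTotalDegree] at hp
    rw [p.as_sum]
    refine Submodule.sum_mem _ fun s hs => ?_
    have h1 : (s.sum fun _ e => e) ≤ t := (le_totalDegree hs).trans hp
    rw [monomial_eq, ← smul_eq_C_mul]
    refine Submodule.smul_mem _ _ ((linSpan_pow_mono X h1) ?_)
    rw [Finsupp.prod, Finsupp.sum]
    simp only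
    rw [← Finset.prod_pow_eq_pow_sum]
    exact prod_mem_prod_submodule fun i _ => Submodule.pow_mem_pow _ (mem_linSpan X i) _
  · induction t with
    | zero =>
      rw [pow_zero, Submodule.one_le, mem_restrictTotalDegree]
      simp
    | succ t ih =>
      rw [pow_succ]
      refine (mul_le_mul' ih (linSpan_le (M := restrictTotalDegree σ k 1) ?_ ?_)).trans ?_
      · simp [mem_restrictTotalDegree]
      · simp [mem_restrictTotalDegree]
      · rw [Submodule.mul_le]
        intro a ha b hb
        rw [mem_restrictTotalDegree] at *
        exact (totalDegree_mul _ _).trans (add_le_add ha hb)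

lemma map_restrictTotalDegree (f : MvPolynomial σ k →ₐ[k] B) (t : ℕ) :
    (restrictTotalDegree σ k t).map f.toLinearMap = linSpan k (fun i => f (X i)) ^ t := by
  rw [restrictTotalDegree_eq_linSpan_pow, Submodule.map_pow, map_linSpan]

lemma aeval_mem_linSpan_pow (v : σ → B) {p : MvPolynomial σ k} {t : ℕ} (hp : p.totalDegree ≤ t) :
    aeval v p ∈ linSpan k v ^ t := by
  have h := map_restrictTotalDegree (aeval v : MvPolynomial σ k →ₐ[k] B) t
  simp only [aeval_X] at h
  rw [← h]
  exact Submodule.mem_map_of_mem ((mem_restrictTotalDegree _ _ _).2 hp)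

lemma exists_of_mem_linSpan_pow (v : σ → B) {b : B} {t : ℕ} (hb : b ∈ linSpan k v ^ t) :
    ∃ p : MvPolynomial σ k, p.totalDegree ≤ t ∧ aeval v p = b := by
  have h := map_restrictTotalDegree (aeval v : MvPolynomial σ k →ₐ[k] B) t
  simp only [aeval_X] at h
  rw [← h] at hb
  obtain ⟨p, hp, rfl⟩ := hb
  exact ⟨p, (mem_restrictTotalDegree _ _ _).1 hp, rfl⟩

lemma affineHilbertFunction_eq (J : Ideal (MvPolynomial σ k)) (t : ℕ) :
    affineHilbertFunction J t =
      Module.finrank k (linSpan k (fun i => Ideal.Quotient.mk J (X i)) ^ t :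
        Submodule k (MvPolynomial σ k ⧸ J)) := by
  rw [affineHilbertFunction, map_restrictTotalDegree]
  rfl

lemma card_degree_le (d t : ℕ) :
    Nat.card {s : Fin d →₀ ℕ | (s.sum fun _ e => e) ≤ t} = (t + d).choose d := by
  have h : {s : Fin d →₀ ℕ | (s.sum fun _ e => e) ≤ t} =
      ↑((Finset.range (t + 1)).biUnion fun j =>
        (Finset.univ : Finset (Fin d)).finsuppAntidiag j) := by
    ext s
    simp only [Set.mem_ofPred_eq, Finset.coe_biUnion, Finset.coe_range, Set.mem_Iio,
      Set.mem_iUnion, Finset.mem_coe, Finset.mem_finsuppAntidiag, Finset.subset_univ, and_true,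
      exists_prop, exists_eq_right', Nat.lt_succ_iff]
    rw [Finsupp.sum_fintype _ _ (fun _ => rfl)]
  rw [h, Nat.card_coe_set_eq, Set.ncard_coe_finset, Finset.card_biUnion]
  · simp only [Finset.card_finsuppAntidiag_nat_eq_multichoose, Finset.card_univ, Fintype.card_fin]
    rw [Nat.sum_range_multichoose]
  · intro i _ j _ hij
    rw [Function.onFun, Finset.disjoint_left]
    intro s hs hs'
    rw [Finset.mem_finsuppAntidiag] at hs hs'
    exact hij (hs.1.symm.trans hs'.1)

lemma finrank_restrictTotalDegree (d t : ℕ) :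
    Module.finrank k (restrictTotalDegree (Fin d) k t) = (t + d).choose d := by
  rw [← card_degree_le, restrictTotalDegree,
    Module.finrank_eq_nat_card_basis (basisRestrictSupport k _)]

lemma finrank_linSpan_pow_le {d : ℕ} (v : Fin d → B) (t : ℕ) :
    Module.finrank k (linSpan k v ^ t : Submodule k B) ≤ (t + d).choose d := by
  have h := map_restrictTotalDegree (aeval v : MvPolynomial (Fin d) k →ₐ[k] B) t
  simp only [aeval_X] at h
  rw [← h, ← finrank_restrictTotalDegree (k := k)]
  exact Submodule.finrank_map_le _ _

lemma finrank_linSpan_pow_of_algebraicIndependent {d : ℕ} {v : Fin d → B}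
    (hv : AlgebraicIndependent k v) (t : ℕ) :
    Module.finrank k (linSpan k v ^ t : Submodule k B) = (t + d).choose d := by
  have h := map_restrictTotalDegree (aeval v : MvPolynomial (Fin d) k →ₐ[k] B) t
  simp only [aeval_X] at h
  rw [← h, ← finrank_restrictTotalDegree (k := k)]
  exact (LinearEquiv.finrank_eq (Submodule.equivMapOfInjective _
    (show Function.Injective (aeval v : MvPolynomial (Fin d) k →ₐ[k] B).toLinearMap from hv)
    _)).symm

end Filtration

/-! ### Elementary estimates for binomial coefficients -/

section Choose

lemma pow_le_factorial_mul_choose (t d : ℕ) : (t + 1) ^ d ≤ d.factorial * (t + d).choose d := by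
  rw [← Nat.ascFactorial_eq_factorial_mul_choose]
  exact Nat.pow_succ_le_ascFactorial _ _

lemma factorial_mul_choose_le_pow (t d : ℕ) : d.factorial * (t + d).choose d ≤ (t + d) ^ d := by
  rw [← Nat.descFactorial_eq_factorial_mul_choose]
  exact Nat.descFactorial_le_pow _ _

lemma choose_le_mul_pow (t d : ℕ) : (t + d).choose d ≤ (d + 1) ^ d * (t + 1) ^ d := by
  rw [← mul_pow]
  refine ((Nat.le_mul_of_pos_left _ d.factorial_pos).trans (factorial_mul_choose_le_pow t d)).trans
    (Nat.pow_le_pow_left (by nlinarith) _)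

lemma exponent_le_of_pow_le {a b C : ℕ} (h : ∀ t : ℕ, (t + 1) ^ a ≤ C * (t + 1) ^ b) : a ≤ b := by
  by_contra! hab
  have h1 := h C
  have h2 : (C + 1) ^ (b + 1) ≤ (C + 1) ^ a := Nat.pow_le_pow_right (by omega) hab
  rw [pow_succ] at h2
  have h3 : 0 < (C + 1) ^ b := by positivity
  nlinarith

end Choose

section Fg

variable {k M : Type*} [Semiring k] [AddCommMonoid M] [Module k M]

lemma exists_le_of_fg_of_monotone {U : Submodule k M} (hU : U.FG) {F : ℕ → Submodule k M}
    (hF : Monotone F) (h : ∀ x ∈ U, ∃ c, x ∈ F c) : ∃ c, U ≤ F c := by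
  obtain ⟨s, rfl⟩ := hU
  have hx : ∀ x : s, ∃ c, (x : M) ∈ F c := fun x => h x (Submodule.subset_span x.2)
  choose c hc using hx
  refine ⟨Finset.univ.sup c, Submodule.span_le.2 fun x hx => ?_⟩
  exact hF (Finset.le_sup (Finset.mem_univ (⟨x, hx⟩ : s))) (hc ⟨x, hx⟩)

end Fg

/-! ### Krull dimension along integral maps -/

section KrullDim

lemma ringKrullDim_le_of_isIntegral {R S : Type*} [CommRing R] [CommRing S] (f : R →+* S)
    (hf : f.IsIntegral) : ringKrullDim S ≤ ringKrullDim R := by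
  algebraize [f]
  have : Algebra.IsIntegral R S := ⟨hf⟩
  refine Order.krullDim_le_of_strictMono (PrimeSpectrum.comap f) fun P Q hPQ => ?_
  exact Ideal.IsIntegral.comap_lt_comap (R := R) (I := P.asIdeal) (J := Q.asIdeal) hPQ

/-- Incomparability gives one inequality. For the other, lying over (from injectivity) lifts the
bottom of a chain of primes and going up lifts the rest. -/
lemma ringKrullDim_eq_of_isIntegral {R S : Type*} [CommRing R] [CommRing S] (f : R →+* S)
    (hf : f.IsIntegral) (hinj : Function.Injective f) : ringKrullDim S = ringKrullDim R := by
  refine le_antisymm (ringKrullDim_le_of_isIntegral f hf) ?_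
  algebraize [f]
  have : Algebra.IsIntegral R S := ⟨hf⟩
  refine iSup_le fun l => ?_
  obtain ⟨P, hP, hPl⟩ : ∃ P : Ideal S, P.IsPrime ∧ P.LiesOver l.head.asIdeal := by
    obtain ⟨P, hP, h⟩ := Ideal.exists_ideal_over_prime_of_isIntegral (S := S)
      l.head.asIdeal ⊥ (by
        rw [← RingHom.ker_eq_comap_bot, RingHom.algebraMap_toAlgebra,
          (RingHom.injective_iff_ker_eq_bot _).1 hinj]
        exact bot_le)
    exact ⟨P, h.1, ⟨h.2.symm⟩⟩
  obtain ⟨L, hL, -⟩ := Ideal.exists_ltSeries_of_hasGoingUp (S := S) l P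
  rw [← hL]
  exact Order.LTSeries.length_le_krullDim L

end KrullDim

/-! ### Growth of the Hilbert function and dimension -/

section Growth

variable {k : Type*} [Field k] {n : ℕ}

/-- Let `Z` be spanned by `1` and the images of the variables, and `E` by `1` and module generators.
The subspaces `Z^c * E` exhaust `A`, so `V * E ≤ Z^c * E` for some `c`; by induction `V^t ≤ Z^(c t)
* E`, and monomials in `s` variables are counted. -/
lemma exists_finrank_pow_le_of_finite {A : Type*} [CommRing A] [Algebra k A] {s : ℕ}
    (g : MvPolynomial (Fin s) k →ₐ[k] A) (hfin : g.Finite) (V : Submodule k A)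
    [Module.Finite k V] :
    ∃ C : ℕ, ∀ t, Module.finrank k (V ^ t : Submodule k A) ≤ C * (t + 1) ^ s := by
  set Z := linSpan k (fun i => g (X i)) with hZ
  let _ := g.toRingHom.toAlgebra
  obtain ⟨G, hG⟩ : (⊤ : Submodule (MvPolynomial (Fin s) k) A).FG := hfin.1
  set E : Submodule k A := Submodule.span k (insert 1 (G : Set A)) with hE
  have : Module.Finite k E := Module.Finite.span_of_finite k (G.finite_toSet.insert 1)
  have hmono : Monotone fun c => Z ^ c * E := fun a b hab =>
    mul_le_mul_left (linSpan_pow_mono _ hab) E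
  have hcov : ∀ a : A, ∃ c, a ∈ Z ^ c * E := by
    intro a
    have ha : a ∈ Submodule.span (MvPolynomial (Fin s) k) (G : Set A) := by rw [hG]; trivial
    induction ha using Submodule.span_induction with
    | mem x hx =>
      refine ⟨0, ?_⟩
      rw [pow_zero, one_mul]
      exact Submodule.subset_span (Set.mem_insert_of_mem _ hx)
    | zero => exact ⟨0, Submodule.zero_mem _⟩
    | add x y _ _ hx hy =>
      obtain ⟨c, hc⟩ := hx
      obtain ⟨c', hc'⟩ := hy
      exact ⟨max c c', Submodule.add_mem _ (hmono (le_max_left _ _) hc)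
        (hmono (le_max_right _ _) hc')⟩
    | smul p x _ hx =>
      obtain ⟨c, hc⟩ := hx
      refine ⟨p.totalDegree + c, ?_⟩
      rw [pow_add, mul_assoc, Algebra.smul_def]
      refine Submodule.mul_mem_mul ?_ hc
      have h := aeval_mem_linSpan_pow (k := k) (fun i => g (X i)) (le_refl p.totalDegree)
      rwa [show aeval (fun i => g (X i)) = g from (aeval_unique g).symm] at h
  have hVE : (V * E).FG := Module.Finite.iff_fg.1 inferInstance
  obtain ⟨c, hc⟩ := exists_le_of_fg_of_monotone hVE hmono fun x _ => hcov x
  have hpow : ∀ t, V ^ t ≤ Z ^ (c * t) * E := by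
    intro t
    induction t with
    | zero =>
      rw [pow_zero, mul_zero, pow_zero, one_mul, Submodule.one_le]
      exact Submodule.subset_span (Set.mem_insert _ _)
    | succ t ih =>
      calc V ^ (t + 1) = V * V ^ t := pow_succ' _ _
        _ ≤ V * (Z ^ (c * t) * E) := mul_le_mul_right ih _
        _ = Z ^ (c * t) * (V * E) := by ring
        _ ≤ Z ^ (c * t) * (Z ^ c * E) := mul_le_mul_right hc _
        _ = Z ^ (c * (t + 1)) * E := by ring
  refine ⟨(s + 1) ^ s * (c + 1) ^ s * Module.finrank k E, fun t => ?_⟩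
  calc Module.finrank k (V ^ t : Submodule k A)
      ≤ Module.finrank k (Z ^ (c * t) * E : Submodule k A) := Submodule.finrank_mono (hpow t)
    _ ≤ Module.finrank k (Z ^ (c * t) : Submodule k A) * Module.finrank k E :=
      Submodule.finrank_mul_le _ _
    _ ≤ ((s + 1) ^ s * (c * t + 1) ^ s) * Module.finrank k E := by
      gcongr
      exact (finrank_linSpan_pow_le _ _).trans (choose_le_mul_pow _ _)
    _ ≤ ((s + 1) ^ s * ((c + 1) ^ s * (t + 1) ^ s)) * Module.finrank k E := by
      gcongr
      rw [← mul_pow]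
      exact Nat.pow_le_pow_left (by nlinarith) _
    _ = _ := by ring

lemma affineHilbertFunction_le_of_ringKrullDim_le (J : Ideal (MvPolynomial (Fin n) k)) {d : ℕ}
    (hd : ringKrullDim (MvPolynomial (Fin n) k ⧸ J) ≤ d) :
    ∃ C : ℕ, ∀ t, affineHilbertFunction J t ≤ C * (t + 1) ^ d := by
  rcases subsingleton_or_nontrivial (MvPolynomial (Fin n) k ⧸ J) with hA | hA
  · refine ⟨0, fun t => ?_⟩
    rw [affineHilbertFunction_eq]
    simp [Module.finrank_zero_of_subsingleton]
  obtain ⟨s, g, hg, hfin⟩ := exists_finite_inj_algHom_of_fg k (MvPolynomial (Fin n) k ⧸ J)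
  have hs : s ≤ d := by
    have h1 := ringKrullDim_eq_of_isIntegral g.toRingHom hfin.to_isIntegral hg
    rw [MvPolynomial.ringKrullDim_of_isNoetherianRing, ringKrullDim_eq_zero_of_field, zero_add] at h1
    rw [h1] at hd
    simpa using hd
  obtain ⟨C, hC⟩ := exists_finrank_pow_le_of_finite g hfin
    (linSpan k (fun i => Ideal.Quotient.mk J (X i)))
  refine ⟨C, fun t => ?_⟩
  rw [affineHilbertFunction_eq]
  exact (hC t).trans (Nat.mul_le_mul_left _ (Nat.pow_le_pow_right (by omega) hs))

/-- The `z i` have degree at most some `c`, so their monomials of degree at most `t` give `(t +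
m).choose m` independent elements of degree at most `c t`. Bounding dimension through Hilbert
functions has the advantage of surviving field extension. -/
lemma le_of_injective_of_affineHilbertFunction_le (J : Ideal (MvPolynomial (Fin n) k)) {d m C : ℕ}
    (hC : ∀ t, affineHilbertFunction J t ≤ C * (t + 1) ^ d) {z : Fin m → MvPolynomial (Fin n) k ⧸ J}
    (hz : AlgebraicIndependent k z) : m ≤ d := by
  set V := linSpan k (fun i => (Ideal.Quotient.mk J (X i) : MvPolynomial (Fin n) k ⧸ J)) with hV
  have hcov : ∀ a : MvPolynomial (Fin n) k ⧸ J, ∃ c, a ∈ V ^ c := by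
    intro a
    obtain ⟨p, rfl⟩ := Ideal.Quotient.mk_surjective a
    refine ⟨p.totalDegree, ?_⟩
    have h := aeval_mem_linSpan_pow (k := k) (fun i => Ideal.Quotient.mk J (X i))
      (le_refl p.totalDegree)
    rwa [show aeval (fun i => Ideal.Quotient.mk J (X i)) = Ideal.Quotient.mkₐ k J from
      (aeval_unique (Ideal.Quotient.mkₐ k J)).symm] at h
  obtain ⟨c, hc⟩ := exists_le_of_fg_of_monotone (U := linSpan k z)
    (Module.Finite.iff_fg.1 inferInstance) (linSpan_pow_mono _) fun x _ => hcov x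
  refine exponent_le_of_pow_le (C := m.factorial * C * (c + 1) ^ d) fun t => ?_
  calc (t + 1) ^ m ≤ m.factorial * (t + m).choose m := pow_le_factorial_mul_choose t m
    _ ≤ m.factorial * (C * (c * t + 1) ^ d) := by
      gcongr
      rw [← finrank_linSpan_pow_of_algebraicIndependent hz]
      refine le_trans ?_ (hC (c * t))
      rw [affineHilbertFunction_eq]
      refine Submodule.finrank_mono ?_
      rw [pow_mul]
      exact pow_le_pow_left' hc t
    _ ≤ m.factorial * (C * ((c + 1) ^ d * (t + 1) ^ d)) := by
      gcongr
      rw [← mul_pow]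
      exact Nat.pow_le_pow_left (by nlinarith) _
    _ = _ := by ring

end Growth

/-! ### Extension of the coefficient field -/

section BaseChange

variable {k K σ : Type*} [Field k] [Field K] [Algebra k K]

/-- The ideal generated by `J` after extending the field of coefficients. -/
abbrev extIdeal (K : Type*) [Field K] [Algebra k K] (J : Ideal (MvPolynomial σ k)) :
    Ideal (MvPolynomial σ K) :=
  J.map (MvPolynomial.map (algebraMap k K))

open TensorProduct in
/-- Applying a linear functional to the coefficients of a polynomial. -/
def mapCoeffs (φ : K →ₗ[k] k) : MvPolynomial σ K →ₗ[k] MvPolynomial σ k :=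
  (TensorProduct.lid k (MvPolynomial σ k)).toLinearMap ∘ₗ
    (LinearMap.rTensor (MvPolynomial σ k) φ) ∘ₗ
      ((algebraTensorAlgEquiv k K).symm.toLinearMap.restrictScalars k)

lemma mapCoeffs_smul_map (φ : K →ₗ[k] k) (c : K) (p : MvPolynomial σ k) :
    mapCoeffs φ (c • MvPolynomial.map (algebraMap k K) p) = φ c • p := by
  have h : (algebraTensorAlgEquiv k K).symm (c • MvPolynomial.map (algebraMap k K) p) =
      c ⊗ₜ[k] p := by
    rw [AlgEquiv.symm_apply_eq, algebraTensorAlgEquiv_tmul]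
  simp [mapCoeffs, h]

lemma exists_eq_sum_smul_map (f : MvPolynomial σ K) {ι : Type*} (b : Module.Basis ι k K) :
    ∃ c : ι →₀ MvPolynomial σ k,
      f = c.sum fun i p => b i • MvPolynomial.map (algebraMap k K) p := by
  obtain ⟨c, hc⟩ := TensorProduct.eq_repr_basis_left b ((algebraTensorAlgEquiv k K).symm f)
  refine ⟨c, ?_⟩
  have h := congrArg (algebraTensorAlgEquiv k K) hc
  rw [AlgEquiv.apply_symm_apply] at h
  rw [← h, Finsupp.sum, map_sum]
  simp only [algebraTensorAlgEquiv_tmul]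
  rfl

lemma mapCoeffs_mul_map (φ : K →ₗ[k] k) (f : MvPolynomial σ K) (p : MvPolynomial σ k) :
    mapCoeffs φ (f * MvPolynomial.map (algebraMap k K) p) = mapCoeffs φ f * p := by
  obtain ⟨c, rfl⟩ := exists_eq_sum_smul_map f (Module.Basis.ofVectorSpace k K)
  rw [Finsupp.sum, Finset.sum_mul, map_sum, map_sum, Finset.sum_mul]
  refine Finset.sum_congr rfl fun i _ => ?_
  rw [smul_mul_assoc, ← map_mul, mapCoeffs_smul_map, mapCoeffs_smul_map, smul_mul_assoc]

lemma mapCoeffs_smul (φ : K →ₗ[k] k) (c : K) (f : MvPolynomial σ K) :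
    mapCoeffs φ (c • f) = mapCoeffs (φ ∘ₗ LinearMap.mulLeft k c) f := by
  obtain ⟨d, rfl⟩ := exists_eq_sum_smul_map f (Module.Basis.ofVectorSpace k K)
  rw [Finsupp.sum, Finset.smul_sum, map_sum, map_sum]
  refine Finset.sum_congr rfl fun i _ => ?_
  rw [smul_smul, mapCoeffs_smul_map, mapCoeffs_smul_map]
  rfl

/-- The extended ideal is `K ⊗ J` inside `K ⊗ k[x]`, and functionals on `K` read off coordinates in
a basis of `K` over `k`. This criterion makes extension commute with arbitrary intersections. -/
lemma mem_extIdeal_iff {J : Ideal (MvPolynomial σ k)} {f : MvPolynomial σ K} :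
    f ∈ extIdeal K J ↔ ∀ φ : K →ₗ[k] k, mapCoeffs φ f ∈ J := by
  constructor
  · intro hf
    refine Submodule.span_induction (p := fun f _ => ∀ φ : K →ₗ[k] k, mapCoeffs φ f ∈ J)
      ?_ ?_ ?_ ?_ (show f ∈ Submodule.span _ _ from hf)
    · rintro _ ⟨p, hp, rfl⟩ φ
      have := mapCoeffs_mul_map φ 1 p
      rw [one_mul] at this
      change mapCoeffs φ (MvPolynomial.map (algebraMap k K) p) ∈ J
      rw [this]
      exact J.mul_mem_left _ hp
    · intro φ
      rw [map_zero]; exact J.zero_mem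
    · intro x y _ _ hx hy φ
      rw [map_add]; exact J.add_mem (hx φ) (hy φ)
    · intro a x _ h φ
      obtain ⟨c, rfl⟩ := exists_eq_sum_smul_map a (Module.Basis.ofVectorSpace k K)
      rw [smul_eq_mul, Finsupp.sum, Finset.sum_mul, map_sum]
      refine Ideal.sum_mem _ fun i _ => ?_
      rw [smul_mul_assoc, mapCoeffs_smul, mul_comm, mapCoeffs_mul_map]
      exact J.mul_mem_right _ (h _)
  · intro h
    obtain ⟨c, rfl⟩ := exists_eq_sum_smul_map f (Module.Basis.ofVectorSpace k K)
    refine Ideal.sum_mem _ fun i _ => ?_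
    simp only [smul_eq_C_mul]
    refine Ideal.mul_mem_left _ _ (Ideal.mem_map_of_mem _ ?_)
    have h1 := h ((Module.Basis.ofVectorSpace k K).coord i)
    rw [Finsupp.sum, map_sum] at h1
    simp only [mapCoeffs_smul_map, Module.Basis.coord_apply, Module.Basis.repr_self] at h1
    classical
    simp only [Finsupp.single_apply, ite_smul, one_smul, zero_smul, Finset.sum_ite_eq',
      Finsupp.mem_support_iff] at h1
    rwa [ite_eq_left_iff.2 (fun h => (not_not.1 h).symm)] at h1

lemma mem_extIdeal_sInf_iff {S : Set (Ideal (MvPolynomial σ k))} {f : MvPolynomial σ K} :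
    f ∈ extIdeal K (sInf S) ↔ ∀ q ∈ S, f ∈ extIdeal K q := by
  simp only [mem_extIdeal_iff, Submodule.mem_sInf]
  exact ⟨fun h q hq φ => h φ q hq, fun h φ q hq => h q hq φ⟩

/-- A `k`-basis of the part of degree at most `t` remains a `K`-basis: functionals on `K` test
independence, and it spans because monomials are defined over `k`. -/
lemma affineHilbertFunction_extIdeal {n : ℕ} (J : Ideal (MvPolynomial (Fin n) k)) (t : ℕ) :
    affineHilbertFunction (extIdeal K J) t = affineHilbertFunction J t := by
  set W : Submodule k (MvPolynomial (Fin n) k ⧸ J) :=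
    (restrictTotalDegree (Fin n) k t).map (Ideal.Quotient.mkₐ k J).toLinearMap with hW
  let b := Module.finBasis k W
  have hb : ∀ i, ∃ p : MvPolynomial (Fin n) k, p.totalDegree ≤ t ∧
      Ideal.Quotient.mk J p = (b i : MvPolynomial (Fin n) k ⧸ J) := by
    intro i
    obtain ⟨p, hp, h⟩ := (b i).2
    exact ⟨p, (mem_restrictTotalDegree _ _ _).1 hp, h⟩
  choose p hpt hp using hb
  let v : Fin (Module.finrank k W) → MvPolynomial (Fin n) K ⧸ extIdeal K J := fun i =>
    Ideal.Quotient.mk _ (MvPolynomial.map (algebraMap k K) (p i))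
  have hv : LinearIndependent K v := by
    rw [Fintype.linearIndependent_iff]
    intro c hc
    have hmem : ∑ i, c i • MvPolynomial.map (algebraMap k K) (p i) ∈ extIdeal K J := by
      rw [← Ideal.Quotient.eq_zero_iff_mem, ← hc, map_sum]
      rfl
    have h0 : ∀ (φ : K →ₗ[k] k) i, φ (c i) = 0 := by
      intro φ
      have h1 := mem_extIdeal_iff.1 hmem φ
      rw [map_sum] at h1
      simp only [mapCoeffs_smul_map] at h1
      rw [← Ideal.Quotient.eq_zero_iff_mem, map_sum] at h1
      refine Fintype.linearIndependent_iff.1 b.linearIndependent (fun i => φ (c i)) ?_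
      apply Subtype.ext
      rw [Submodule.coe_sum, Submodule.coe_zero, ← h1]
      refine Finset.sum_congr rfl fun i _ => ?_
      rw [Submodule.coe_smul, ← hp]
      rfl
    intro i
    exact (Module.forall_dual_apply_eq_zero_iff k (c i)).1 fun φ => h0 φ i
  have hspan : Submodule.span K (Set.range v) =
      (restrictTotalDegree (Fin n) K t).map (Ideal.Quotient.mkₐ K (extIdeal K J)).toLinearMap := by
    apply le_antisymm
    · rw [Submodule.span_le]
      rintro _ ⟨i, rfl⟩
      refine Submodule.mem_map_of_mem ((mem_restrictTotalDegree _ _ _).2 ?_)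
      exact (Finset.sup_mono (support_map_subset _ _)).trans (hpt i)
    · rw [restrictTotalDegree, restrictSupport_eq_span, Submodule.map_span, Submodule.span_le]
      rintro _ ⟨_, ⟨s, hs, rfl⟩, rfl⟩
      have hs' : (Ideal.Quotient.mk J (monomial s 1)) ∈ W := by
        refine Submodule.mem_map_of_mem (f := (Ideal.Quotient.mkₐ k J).toLinearMap)
          ((mem_restrictTotalDegree _ _ _).2 ?_)
        exact (totalDegree_monomial_le _ _).trans hs
      have h1 := b.sum_repr ⟨_, hs'⟩
      have h2 : monomial s 1 - ∑ i, b.repr ⟨_, hs'⟩ i • p i ∈ J := by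
        rw [← Ideal.Quotient.eq_zero_iff_mem, map_sub, map_sum, sub_eq_zero]
        have h3 := congrArg Subtype.val h1
        rw [Submodule.coe_sum] at h3
        refine h3.symm.trans ?_
        refine Finset.sum_congr rfl fun i _ => ?_
        rw [Submodule.coe_smul, ← hp]
        rfl
      have h4 := Ideal.mem_map_of_mem (MvPolynomial.map (algebraMap k K)) h2
      rw [map_sub, map_sum, ← Ideal.Quotient.eq_zero_iff_mem, map_sub, map_sum, sub_eq_zero,
        map_monomial, map_one] at h4
      change Ideal.Quotient.mk _ (monomial s 1) ∈ _
      rw [h4]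
      refine Submodule.sum_mem _ fun i _ => ?_
      rw [smul_eq_C_mul, map_mul, map_C, ← smul_eq_C_mul]
      exact Submodule.smul_mem _ _ (Submodule.subset_span (Set.mem_range_self (f := v) i))
  rw [affineHilbertFunction, ← hspan, finrank_span_eq_card hv, Fintype.card_fin,
    affineHilbertFunction]

end BaseChange

section LinSpanFintype

variable {k σ τ B : Type*} [Field k] [CommRing B] [Algebra k B]

lemma linSpan_comp_equiv (e : τ ≃ σ) (v : σ → B) : linSpan k (v ∘ e) = linSpan k v := by
  rw [linSpan, linSpan, e.surjective.range_comp]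

lemma finrank_linSpan_pow_le_card [Fintype σ] (v : σ → B) (t : ℕ) :
    Module.finrank k (linSpan k v ^ t : Submodule k B) ≤
      (t + Fintype.card σ).choose (Fintype.card σ) := by
  rw [← linSpan_comp_equiv (Fintype.equivFin σ).symm]
  exact finrank_linSpan_pow_le _ _

lemma finrank_linSpan_pow_eq_card [Fintype σ] {v : σ → B} (hv : AlgebraicIndependent k v) (t : ℕ) :
    Module.finrank k (linSpan k v ^ t : Submodule k B) =
      (t + Fintype.card σ).choose (Fintype.card σ) := by
  rw [← linSpan_comp_equiv (Fintype.equivFin σ).symm]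
  exact finrank_linSpan_pow_of_algebraicIndependent
    (hv.comp _ (Fintype.equivFin σ).symm.injective) t

end LinSpanFintype

/-! ### Generic linear forms have no common zero at infinity: the count -/

section Count

variable {k κ : Type*} [Field k] [Field κ] [Algebra k κ] {n d : ℕ}

/-- Here `ξ` is a point at infinity of a scheme with Hilbert function `H`. The part at infinity has
dimension at most `d - 1`, so `ξ` contributes at most `d - 1` parameters. The relations express each
`u (l, i₀)` through `ξ` and the other `d (n - 1)` entries, leaving fewer than `d n` parameters for
`d n` independent elements. Growth of filtrations replaces transcendence degree. -/
lemma false_of_generic_relation {u : Fin d × Fin n → κ} (hu : AlgebraicIndependent k u)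
    {ξ : Fin n → κ} {i₀ : Fin n} (hξ : ξ i₀ = 1) (hrel : ∀ l, ∑ i, u (l, i) * ξ i = 0)
    {H : ℕ → ℕ} {C : ℕ} (hH : ∀ t, H t ≤ C * (t + 1) ^ d)
    (hw : ∀ t, H t + Module.finrank k (linSpan k ξ ^ (t + 1) : Submodule k κ) ≤ H (t + 1)) :
    False := by
  set w : ℕ → ℕ := fun t => Module.finrank k (linSpan k ξ ^ t : Submodule k κ) with hwdef
  have hwmono : Monotone w := fun a b hab => Submodule.finrank_mono (linSpan_pow_mono ξ hab)
  -- The `m` increments of `H` from `t` to `t + m` are each at least `w t`. With `m = t + 1` this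
  -- makes `w` one order smaller than `H`.
  have h1 : ∀ t m, m * w t ≤ H (t + m) := by
    intro t m
    induction m with
    | zero => simp
    | succ m ih =>
      have h2 := hw (t + m)
      have h3 : w t ≤ w (t + m + 1) := hwmono (by omega)
      rw [add_mul, one_mul]
      exact (add_le_add ih h3).trans h2
  have h2 : ∀ t, (t + 1) * w t ≤ C * 2 ^ d * (t + 1) ^ d := by
    intro t
    refine (h1 t (t + 1)).trans ((hH _).trans ?_)
    rw [mul_assoc, ← mul_pow]
    exact Nat.mul_le_mul_left _ (Nat.pow_le_pow_left (by omega) _)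
  let u' : Fin d × {i : Fin n // i ≠ i₀} → κ := fun x => u (x.1, x.2)
  have hU : linSpan k u ≤ linSpan k u' * linSpan k ξ := by
    have hone : (1 : κ) ∈ linSpan k ξ := Submodule.one_le.1 (one_le_linSpan ξ)
    refine linSpan_le ?_ ?_
    · rw [← mul_one (1 : κ)]
      exact Submodule.mul_mem_mul (Submodule.one_le.1 (one_le_linSpan u')) hone
    · rintro ⟨l, i⟩
      by_cases hi : i = i₀
      · subst hi
        have h3 := hrel l
        rw [← Finset.add_sum_erase _ _ (Finset.mem_univ i), hξ, mul_one] at h3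
        rw [eq_neg_of_add_eq_zero_left h3]
        refine Submodule.neg_mem _ (Submodule.sum_mem _ fun j hj => ?_)
        exact Submodule.mul_mem_mul (mem_linSpan u' (l, ⟨j, Finset.ne_of_mem_erase hj⟩))
          (mem_linSpan ξ j)
      · rw [← mul_one (u (l, i))]
        exact Submodule.mul_mem_mul (mem_linSpan u' (l, ⟨i, hi⟩)) hone
  have hn : 0 < n := i₀.pos
  set m := d * (n - 1) with hm
  have hmd : m + d = d * n := by
    obtain ⟨n', rfl⟩ : ∃ n', n = n' + 1 := ⟨n - 1, by omega⟩
    simp [hm, mul_add]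
  have hcard : Fintype.card (Fin d × {i : Fin n // i ≠ i₀}) = m := by
    simp [hm, Fintype.card_subtype_compl]
  have hcard' : Fintype.card (Fin d × Fin n) = d * n := by simp
  have h3 : ∀ t, (t + d * n).choose (d * n) ≤ (t + m).choose m * w t := by
    intro t
    have h4 := finrank_linSpan_pow_eq_card hu t
    rw [hcard'] at h4
    rw [← h4]
    calc Module.finrank k (linSpan k u ^ t : Submodule k κ)
        ≤ Module.finrank k (linSpan k u' ^ t * linSpan k ξ ^ t : Submodule k κ) := by
          refine Submodule.finrank_mono ?_
          rw [← mul_pow]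
          exact pow_le_pow_left' hU t
      _ ≤ _ := (Submodule.finrank_mul_le _ _)
      _ ≤ _ := by
          have h5 := finrank_linSpan_pow_le_card (k := k) u' t
          rw [hcard] at h5
          exact Nat.mul_le_mul_right _ h5
  have h4 : ∀ t : ℕ, (t + 1) ^ (d * n + 1) ≤
      ((d * n).factorial * (m + 1) ^ m * (C * 2 ^ d)) * (t + 1) ^ (d * n) := by
    intro t
    calc (t + 1) ^ (d * n + 1) = (t + 1) ^ (d * n) * (t + 1) := pow_succ _ _
      _ ≤ ((d * n).factorial * (t + d * n).choose (d * n)) * (t + 1) :=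
        Nat.mul_le_mul_right _ (pow_le_factorial_mul_choose _ _)
      _ ≤ ((d * n).factorial * ((t + m).choose m * w t)) * (t + 1) := by
        gcongr
        exact h3 t
      _ = (d * n).factorial * (t + m).choose m * ((t + 1) * w t) := by ring
      _ ≤ (d * n).factorial * ((m + 1) ^ m * (t + 1) ^ m) * (C * 2 ^ d * (t + 1) ^ d) := by
        exact Nat.mul_le_mul (Nat.mul_le_mul_left _ (choose_le_mul_pow _ _)) (h2 t)
      _ = _ := by rw [← hmd]; ring
  have := exponent_le_of_pow_le h4
  omega

end Count

/-! ### Points at infinity from the Rees algebra -/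

section Rees

universe v

variable {K : Type*} {A : Type v} [Field K] [CommRing A] [Algebra K A]

lemma exists_algHom_field (P : Ideal A) [P.IsPrime] :
    ∃ (κ : Type v) (_ : Field κ) (_ : Algebra K κ) (ρ : A →ₐ[K] κ), ∀ f, ρ f = 0 ↔ f ∈ P := by
  refine ⟨FractionRing (A ⧸ P), inferInstance, inferInstance,
    (IsScalarTower.toAlgHom K (A ⧸ P) (FractionRing (A ⧸ P))).comp (Ideal.Quotient.mkₐ K P),
    fun f => ?_⟩
  change algebraMap _ (FractionRing (A ⧸ P)) (Ideal.Quotient.mk P f) = 0 ↔ _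
  rw [FaithfulSMul.algebraMap_eq_zero_iff, Ideal.Quotient.eq_zero_iff_mem]

/-- The Rees algebra of the filtration of `A` by the powers of the subspace `V`. -/
def powReesAlgebra (V : Submodule K A) : Subalgebra K (Polynomial A) where
  carrier := {f | ∀ t, f.coeff t ∈ V ^ t}
  mul_mem' := by
    intro f g hf hg t
    rw [Polynomial.coeff_mul]
    refine Submodule.sum_mem _ fun ij hij => ?_
    rw [← Finset.HasAntidiagonal.mem_antidiagonal.1 hij, pow_add]
    exact Submodule.mul_mem_mul (hf _) (hg _)
  add_mem' := by
    intro f g hf hg t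
    rw [Polynomial.coeff_add]
    exact Submodule.add_mem _ (hf t) (hg t)
  algebraMap_mem' := by
    intro c t
    rw [Polynomial.algebraMap_apply, Polynomial.coeff_C]
    split_ifs with h
    · subst h
      rw [pow_zero]
      exact Submodule.algebraMap_mem c
    · exact Submodule.zero_mem _

/-- The degree `t` part of the Rees algebra. -/
def powReesMonomial (V : Submodule K A) (t : ℕ) : ↥(V ^ t) →ₗ[K] powReesAlgebra V where
  toFun a := ⟨Polynomial.monomial t (a : A), by
    intro s
    rw [Polynomial.coeff_monomial]
    split_ifs with h
    · subst h; exact a.2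
    · exact Submodule.zero_mem _⟩
  map_add' a b := by
    apply Subtype.ext
    simp
  map_smul' c a := by
    apply Subtype.ext
    exact (Polynomial.smul_monomial c t (a : A)).symm

lemma powReesMonomial_mul (V : Submodule K A) {s t : ℕ} (a : ↥(V ^ s)) (b : ↥(V ^ t))
    (h : (a : A) * b ∈ V ^ (s + t)) :
    powReesMonomial V (s + t) ⟨a * b, h⟩ = powReesMonomial V s a * powReesMonomial V t b := by
  apply Subtype.ext
  simp [powReesMonomial, Polynomial.monomial_mul_monomial]

/-- In the Rees algebra let `S` be the unit placed in degree one (its zeros are the points at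
infinity), and let `Q` be generated by `S` and the linear forms `ζ l`. Either every coordinate `η i`
is nilpotent modulo `Q`, and comparing coefficients gives the first alternative. Or some prime over
`Q` avoids an `η i₀`: a common zero at infinity, with homogeneous coordinates `ξ`. Then `ψ t`
evaluates degree `t` at this point and kills everything of lower degree. -/
lemma exists_pow_mem_or_exists_field {n d : ℕ} (x : Fin n → A) (u : Fin d × Fin n → K) :
    (∃ e : ℕ, ∀ i, x i ^ (e + 1) ∈
      linSpan K (fun l => ∑ i, u (l, i) • x i) * linSpan K x ^ e) ∨
    ∃ (κ : Type v) (_ : Field κ) (_ : Algebra K κ) (ψ : ∀ t, ↥(linSpan K x ^ t) →ₗ[K] κ)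
      (ξ : Fin n → κ) (i₀ : Fin n), ξ i₀ = 1 ∧ (∀ l, ∑ i, algebraMap K κ (u (l, i)) * ξ i = 0) ∧
      (∀ i h, ψ 1 ⟨x i, h⟩ = ξ i) ∧ (∀ h, ψ 0 ⟨1, h⟩ = 1) ∧
      (∀ t a h h', a ∈ linSpan K x ^ t → ψ (t + 1) ⟨a, h⟩ = ψ (t + 1) ⟨a, h'⟩ ∧
        ψ (t + 1) ⟨a, h⟩ = 0) ∧
      (∀ s t a b ha hb h, ψ (s + t) ⟨a * b, h⟩ = ψ s ⟨a, ha⟩ * ψ t ⟨b, hb⟩) := by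
  set V := linSpan K x with hV
  set y : Fin d → A := fun l => ∑ i, u (l, i) • x i with hy
  have hxV : ∀ i, x i ∈ V ^ 1 := fun i => by rw [pow_one]; exact mem_linSpan x i
  have h1V : (1 : A) ∈ V ^ 1 := by rw [pow_one]; exact Submodule.one_le.1 (one_le_linSpan x)
  have hyV : ∀ l, y l ∈ V ^ 1 := fun l =>
    Submodule.sum_mem _ fun i _ => Submodule.smul_mem _ _ (hxV i)
  let S : powReesAlgebra V := powReesMonomial V 1 ⟨1, h1V⟩
  let η : Fin n → powReesAlgebra V := fun i => powReesMonomial V 1 ⟨x i, hxV i⟩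
  let ζ : Fin d → powReesAlgebra V := fun l => powReesMonomial V 1 ⟨y l, hyV l⟩
  have hζ : ∀ l, ζ l = ∑ i, u (l, i) • η i := by
    intro l
    simp only [ζ, η, ← map_smul, ← map_sum]
    congr 1
    apply Subtype.ext
    simp [hy]
  let Q : Ideal (powReesAlgebra V) := Ideal.span (insert S (Set.range ζ))
  -- The generators of `Q` sit in degree one, so elements of `Q` have no constant term, and each
  -- multiplication raises the power of `V` by the degree of the factor.
  have hQ : ∀ f ∈ Q, (f : Polynomial A).coeff 0 = 0 ∧
      ∀ t, (f : Polynomial A).coeff (t + 1) ∈ linSpan K y * V ^ t := by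
    intro f hf
    induction hf using Submodule.span_induction with
    | mem f hf =>
      rcases hf with rfl | ⟨l, rfl⟩
      · refine ⟨by simp [S, powReesMonomial, Polynomial.coeff_monomial], fun t => ?_⟩
        simp only [S, powReesMonomial, LinearMap.coe_mk, AddHom.coe_mk, Polynomial.coeff_monomial]
        split_ifs with h
        · rw [← mul_one (1 : A)]
          exact Submodule.mul_mem_mul (Submodule.one_le.1 (one_le_linSpan y))
            (Submodule.one_le.1 (one_le_pow₀ (one_le_linSpan x)))
        · exact Submodule.zero_mem _
      · refine ⟨by simp [ζ, powReesMonomial, Polynomial.coeff_monomial], fun t => ?_⟩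
        simp only [ζ, powReesMonomial, LinearMap.coe_mk, AddHom.coe_mk, Polynomial.coeff_monomial]
        split_ifs with h
        · rw [← mul_one (y l)]
          exact Submodule.mul_mem_mul (mem_linSpan y l)
            (Submodule.one_le.1 (one_le_pow₀ (one_le_linSpan x)))
        · exact Submodule.zero_mem _
    | zero => exact ⟨by simp, fun t => by simp⟩
    | add f g _ _ hf hg =>
      refine ⟨by simp [hf.1, hg.1], fun t => ?_⟩
      simp only [Subalgebra.coe_add, Polynomial.coeff_add]
      exact Submodule.add_mem _ (hf.2 t) (hg.2 t)
    | smul r f _ hf =>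
      refine ⟨by simp [Polynomial.mul_coeff_zero, hf.1], fun t => ?_⟩
      simp only [smul_eq_mul, Subalgebra.coe_mul, Polynomial.coeff_mul]
      refine Submodule.sum_mem _ fun ij hij => ?_
      obtain ⟨i, j⟩ := ij
      rw [Finset.HasAntidiagonal.mem_antidiagonal] at hij
      simp only at hij ⊢
      rcases j with _ | j
      · rw [hf.1, mul_zero]; exact Submodule.zero_mem _
      · have h1 := Submodule.mul_mem_mul (r.2 i) (hf.2 j)
        have h2 : V ^ i * (linSpan K y * V ^ j) = linSpan K y * V ^ t := by
          rw [show t = i + j by omega, pow_add]; ring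
        rwa [h2] at h1
  by_cases hrad : ∀ i, η i ∈ Q.radical
  · left
    choose e he using hrad
    refine ⟨Finset.univ.sup e, fun i => ?_⟩
    have h1 : η i ^ (Finset.univ.sup e + 1) ∈ Q :=
      Ideal.pow_mem_of_pow_mem _ (he i)
        ((Finset.le_sup (f := e) (Finset.mem_univ i)).trans (Nat.le_succ _))
    have h2 := (hQ _ h1).2 (Finset.univ.sup e)
    simpa [η, powReesMonomial, Polynomial.monomial_pow] using h2
  · right
    push Not at hrad
    obtain ⟨i₀, hi₀⟩ := hrad
    obtain ⟨P, hQP, hP, hηP⟩ : ∃ P : Ideal (powReesAlgebra V), Q ≤ P ∧ P.IsPrime ∧ η i₀ ∉ P := by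
      rw [Ideal.radical_eq_sInf, Submodule.mem_sInf] at hi₀
      push Not at hi₀
      obtain ⟨P, ⟨h1, h2⟩, h3⟩ := hi₀
      exact ⟨P, h1, h2, h3⟩
    obtain ⟨κ, _, _, ρ, hρ⟩ := exists_algHom_field (K := K) P
    -- Division by `τ ^ t` in degree `t` dehomogenizes, with `ξ i₀ = 1`.
    set τ := ρ (η i₀) with hτ
    have hτ0 : τ ≠ 0 := fun h => hηP ((hρ _).1 h)
    refine ⟨κ, inferInstance, inferInstance,
      fun t => (LinearMap.mulRight K (τ ^ t)⁻¹) ∘ₗ ρ.toLinearMap ∘ₗ powReesMonomial V t,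
      fun i => ρ (η i) * τ⁻¹, i₀, mul_inv_cancel₀ hτ0, ?_, ?_, ?_, ?_, ?_⟩
    · intro l
      have h1 : ρ (ζ l) = 0 :=
        (hρ _).2 (hQP (Ideal.subset_span (Set.mem_insert_of_mem _ ⟨l, rfl⟩)))
      rw [hζ, map_sum] at h1
      simp_rw [← mul_assoc]
      rw [← Finset.sum_mul]
      simp_rw [map_smul, Algebra.smul_def] at h1
      rw [h1, zero_mul]
    · intro i h
      simp only [LinearMap.comp_apply, LinearMap.mulRight_apply, pow_one]
      rfl
    · intro h
      simp only [LinearMap.comp_apply, LinearMap.mulRight_apply, pow_zero, inv_one, mul_one]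
      have : powReesMonomial V 0 ⟨1, h⟩ = 1 := by
        apply Subtype.ext
        simp [powReesMonomial]
      rw [this]
      exact map_one ρ
    · intro t a h h' ha
      refine ⟨rfl, ?_⟩
      simp only [LinearMap.comp_apply, LinearMap.mulRight_apply]
      have h1 : powReesMonomial V (t + 1) ⟨a, h⟩ = powReesMonomial V t ⟨a, ha⟩ * S := by
        rw [← powReesMonomial_mul]
        · simp
        · simpa using h
      have h2 : ρ S = 0 := (hρ _).2 (hQP (Ideal.subset_span (Set.mem_insert _ _)))
      rw [h1]
      change ρ (_ * S) * _ = 0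
      rw [map_mul, h2, mul_zero, zero_mul]
    · intro s t a b ha hb h
      simp only [LinearMap.comp_apply, LinearMap.mulRight_apply]
      rw [powReesMonomial_mul V ⟨a, ha⟩ ⟨b, hb⟩ h]
      change ρ (_ * _) * _ = (ρ _ * _) * (ρ _ * _)
      rw [map_mul, pow_add, mul_inv]
      ring

end Rees

/-! ### Noether normalization by generic linear forms -/

section StrongNoether

variable {k K A : Type*} [Field k] [Field K] [CommRing A] [Algebra k K] [Algebra K A]
  [Algebra k A] [IsScalarTower k K A] {n d : ℕ}

lemma linSpan_pow_le_restrictScalars (x : Fin n → A) (t : ℕ) :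
    linSpan k x ^ t ≤ (linSpan K x ^ t).restrictScalars k := by
  intro a ha
  obtain ⟨p, hp, rfl⟩ := exists_of_mem_linSpan_pow x ha
  rw [Submodule.restrictScalars_mem]
  have h := aeval_mem_linSpan_pow (k := K) x (p := MvPolynomial.map (algebraMap k K) p) (t := t)
    ((Finset.sup_mono (support_map_subset _ _)).trans hp)
  rwa [aeval_map_algebraMap] at h

/-- A common zero at infinity is impossible. Restricted to the `k`-span of the monomials in `x`,
evaluation in degree `t + 1` has range containing `linSpan k ξ ^ (t + 1)` and kernel containing all
of degree at most `t`. Rank–nullity yields the increments needed by `false_of_generic_relation`. The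
filtration has to be taken over `k`, since the `u` are independent only over `k`. -/
lemma exists_pow_mem_of_algebraicIndependent (x : Fin n → A) {C : ℕ}
    (hC : ∀ t, Module.finrank k (linSpan k x ^ t : Submodule k A) ≤ C * (t + 1) ^ d)
    {u : Fin d × Fin n → K} (hu : AlgebraicIndependent k u) :
    ∃ e : ℕ, ∀ i, x i ^ (e + 1) ∈
      linSpan K (fun l => ∑ i, u (l, i) • x i) * linSpan K x ^ e := by
  refine (exists_pow_mem_or_exists_field x u).resolve_right ?_
  rintro ⟨κ, _, _, ψ, ξ, i₀, hξ, hrel, hψ1, hψ0, hkill, hmul⟩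
  let _ : Algebra k κ := ((algebraMap K κ).comp (algebraMap k K)).toAlgebra
  have : IsScalarTower k K κ := IsScalarTower.of_algebraMap_eq fun _ => rfl
  have hle := linSpan_pow_le_restrictScalars (k := k) (K := K) x
  let θ : ∀ t, ↥(linSpan k x ^ t) →ₗ[k] κ := fun t =>
    ((ψ t).restrictScalars k) ∘ₗ Submodule.inclusion (hle t)
  have hθ : ∀ t a h, θ t ⟨a, h⟩ = ψ t ⟨a, hle t h⟩ := fun _ _ _ => rfl
  have hx1 : ∀ i, x i ∈ linSpan k x ^ 1 := fun i => by rw [pow_one]; exact mem_linSpan x i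
  have hrange : ∀ t, linSpan k ξ ^ t ≤ LinearMap.range (θ t) := by
    have h1 : linSpan k ξ ≤ LinearMap.range (θ 1) := by
      have h2 : ∀ i, ξ i ∈ LinearMap.range (θ 1) := fun i =>
        ⟨⟨x i, hx1 i⟩, (hθ _ _ _).trans (hψ1 i _)⟩
      refine linSpan_le ?_ h2
      rw [← hξ]
      exact h2 i₀
    intro t
    induction t with
    | zero =>
      rw [pow_zero, Submodule.one_le]
      exact ⟨⟨1, by rw [pow_zero]; exact Submodule.one_le.1 le_rfl⟩, (hθ _ _ _).trans (hψ0 _)⟩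
    | succ t ih =>
      rw [pow_succ, Submodule.mul_le]
      intro a ha b hb
      obtain ⟨⟨a', ha'⟩, rfl⟩ := ih ha
      obtain ⟨⟨b', hb'⟩, rfl⟩ := h1 hb
      have hab : a' * b' ∈ linSpan k x ^ (t + 1) := by
        rw [pow_add]; exact Submodule.mul_mem_mul ha' hb'
      refine ⟨⟨a' * b', hab⟩, ?_⟩
      rw [hθ, hθ, hθ]
      exact hmul _ _ _ _ _ _ _
  refine false_of_generic_relation (k := k) (u := fun p => algebraMap K κ (u p)) ?_ hξ hrel hC ?_
  · exact hu.map' (f := IsScalarTower.toAlgHom k K κ) (algebraMap K κ).injective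
  · intro t
    have h1 := LinearMap.finrank_range_add_finrank_ker (θ (t + 1))
    have h2 := Submodule.finrank_mono (hrange (t + 1))
    have h3 : Module.finrank k (linSpan k x ^ t : Submodule k A) ≤
        Module.finrank k (LinearMap.ker (θ (t + 1))) := by
      let ι : ↥(linSpan k x ^ t) →ₗ[k] LinearMap.ker (θ (t + 1)) :=
        LinearMap.codRestrict _ (Submodule.inclusion (linSpan_pow_mono x (Nat.le_succ t)))
          (fun a => by
            rw [LinearMap.mem_ker]
            exact (hkill t a _ (hle _ (linSpan_pow_mono x (Nat.le_succ t) a.2))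
              (hle t a.2)).2)
      refine LinearMap.finrank_le_finrank_of_injective (f := ι) fun a b hab => ?_
      exact Subtype.ext (congrArg (fun z : LinearMap.ker (θ (t + 1)) =>
        ((z : ↥(linSpan k x ^ (t + 1))) : A)) hab)
    omega

/-- Pigeonhole: a monomial of degree `t + 1 > n e` has an exponent above `e`, and that power of the
variable can be rewritten. -/
lemma linSpan_pow_succ_le_of_pow_mem {x : Fin n → A} {Z : Submodule K A} (hZ : 1 ≤ Z) {e : ℕ}
    (he : ∀ i, x i ^ (e + 1) ∈ Z * linSpan K x ^ e) {t : ℕ} (ht : n * e ≤ t) :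
    linSpan K x ^ (t + 1) ≤ Z * linSpan K x ^ t := by
  intro a ha
  obtain ⟨p, hp, rfl⟩ := exists_of_mem_linSpan_pow x ha
  rw [p.as_sum, map_sum]
  refine Submodule.sum_mem _ fun s hs => ?_
  have hs1 : (s.sum fun _ e => e) ≤ t + 1 := (le_totalDegree hs).trans hp
  rcases Nat.lt_or_ge t (s.sum fun _ e => e) with hlt | hge
  · obtain ⟨i, hi⟩ : ∃ i, e + 1 ≤ s i := by
      by_contra! h
      have : (s.sum fun _ e => e) ≤ n * e := by
        rw [Finsupp.sum_fintype _ _ (fun _ => rfl)]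
        refine (Finset.sum_le_card_nsmul _ _ e fun i _ => Nat.lt_succ_iff.1 (h i)).trans ?_
        simp
      omega
    have hdec : s = Finsupp.single i (e + 1) + (s - Finsupp.single i (e + 1)) :=
      (add_tsub_cancel_of_le (Finsupp.single_le_iff.2 hi)).symm
    set s' := s - Finsupp.single i (e + 1)
    have hs' : (s'.sum fun _ e => e) ≤ t - e := by
      have h1 : (s.sum fun _ e => e) = (e + 1) + (s'.sum fun _ e => e) := by
        rw [hdec, Finsupp.sum_add_index' (fun _ => rfl) (fun _ _ _ => rfl),
          Finsupp.sum_single_index rfl]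
      omega
    have h2 : monomial s (coeff s p) = X i ^ (e + 1) * monomial s' (coeff s p) := by
      rw [X_pow_eq_monomial, monomial_mul, one_mul, ← hdec]
    rw [h2, map_mul, map_pow, aeval_X]
    have hte : e ≤ t := by
      have : 0 < n := i.pos
      nlinarith
    have h3 := Submodule.mul_mem_mul (he i)
      (aeval_mem_linSpan_pow x ((totalDegree_monomial_le s' (coeff s p)).trans hs'))
    rwa [mul_assoc, ← pow_add, Nat.add_sub_cancel' hte] at h3
  · have h1 := aeval_mem_linSpan_pow x ((totalDegree_monomial_le s (coeff s p)).trans hge)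
    exact (le_mul_of_one_le_left' hZ : linSpan K x ^ t ≤ Z * linSpan K x ^ t) h1

/-- Noether normalization by generic linear forms, with control of degrees. -/
lemma exists_linSpan_pow_le_of_algebraicIndependent (x : Fin n → A) {C : ℕ}
    (hC : ∀ t, Module.finrank k (linSpan k x ^ t : Submodule k A) ≤ C * (t + 1) ^ d)
    {u : Fin d × Fin n → K} (hu : AlgebraicIndependent k u) :
    ∃ e : ℕ, ∀ t, linSpan K x ^ (e + t) ≤
      linSpan K (fun l => ∑ i, u (l, i) • x i) ^ t * linSpan K x ^ e := by
  obtain ⟨e, he⟩ := exists_pow_mem_of_algebraicIndependent x hC hu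
  set Z := linSpan K (fun l => ∑ i, u (l, i) • x i)
  refine ⟨n * e, fun t => ?_⟩
  induction t with
  | zero => simp
  | succ t ih =>
    calc linSpan K x ^ (n * e + t + 1) ≤ Z * linSpan K x ^ (n * e + t) :=
          linSpan_pow_succ_le_of_pow_mem (one_le_linSpan _) he (Nat.le_add_right _ _)
      _ ≤ Z * (Z ^ t * linSpan K x ^ (n * e)) := mul_le_mul_right ih _
      _ = _ := by rw [pow_succ]; ring

end StrongNoether

/-! ### Squeezing the leading coefficient -/

section Limits

open Filter Topology

lemma tendsto_add_div_add (a b : ℝ) :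
    Tendsto (fun t : ℕ => ((t : ℝ) + a) / ((t : ℝ) + b)) atTop (𝓝 1) := by
  have h1 : Tendsto (fun t : ℕ => (t : ℝ) + b) atTop atTop :=
    tendsto_atTop_add_const_right _ _ tendsto_natCast_atTop_atTop
  have h2 : Tendsto (fun t : ℕ => 1 + (a - b) / ((t : ℝ) + b)) atTop (𝓝 (1 + 0)) :=
    tendsto_const_nhds.add (h1.const_div_atTop _)
  rw [add_zero] at h2
  refine h2.congr' ?_
  filter_upwards [h1.eventually_gt_atTop 0] with t ht
  field_simp
  ring

lemma tendsto_factorial_mul_choose_div (d a b : ℕ) :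
    Tendsto (fun t : ℕ => (d.factorial : ℝ) * ((t + a + d).choose d : ℝ) / ((t + b : ℕ) : ℝ) ^ d)
      atTop (𝓝 1) := by
  have h1 := (tendsto_add_div_add (a + 1) b).pow d
  have h2 := (tendsto_add_div_add (a + d) b).pow d
  rw [one_pow] at h1 h2
  refine tendsto_of_tendsto_of_tendsto_of_le_of_le h1 h2 (fun t => ?_) (fun t => ?_)
  · simp only [div_pow]
    rw [Nat.cast_add t b]
    gcongr
    exact_mod_cast pow_le_factorial_mul_choose (t + a) d
  · simp only [div_pow]
    rw [Nat.cast_add t b]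
    gcongr
    have := factorial_mul_choose_le_pow (t + a) d
    rw [← add_assoc]
    exact_mod_cast this

/-- The lower bound comes from `N` independent elements, the upper one from `M` generators with `M -
N` independent relations. Fixed shifts do not affect the leading coefficient. -/
lemma tendsto_of_choose_bounds {H : ℕ → ℕ} {d N M c c' : ℕ} (hNM : N ≤ M)
    (hlow : ∀ t, N * (t + d).choose d ≤ H (t + c))
    (hup : ∀ t, H (t + c') + (M - N) * (t + d).choose d ≤ M * (t + c' + d).choose d) :
    Tendsto (fun t : ℕ => (d.factorial : ℝ) * (H t : ℝ) / (t : ℝ) ^ d) atTop (𝓝 N) := by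
  rw [← tendsto_add_atTop_iff_nat (c + c')]
  have h1 := (tendsto_factorial_mul_choose_div d c' (c + c')).const_mul (N : ℝ)
  have h2 := ((tendsto_factorial_mul_choose_div d (c + c') (c + c')).const_mul (M : ℝ)).sub
    ((tendsto_factorial_mul_choose_div d c (c + c')).const_mul ((M : ℝ) - N))
  have h3 : (M : ℝ) * 1 - ((M : ℝ) - N) * 1 = N := by ring
  rw [mul_one] at h1
  rw [h3] at h2
  refine tendsto_of_tendsto_of_tendsto_of_le_of_le h1 h2 (fun t => ?_) (fun t => ?_)
  · have h4 := hlow (t + c')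
    rw [show t + c' + c = t + (c + c') by ring] at h4
    have h5 : (N : ℝ) * ((t + c' + d).choose d : ℝ) ≤ (H (t + (c + c')) : ℝ) := by exact_mod_cast h4
    simp only
    rw [← mul_div_assoc, mul_left_comm]
    gcongr
  · have h4 := hup (t + c)
    rw [show t + c + c' = t + (c + c') by ring] at h4
    have h5 : (H (t + (c + c')) : ℝ) + ((M : ℝ) - N) * ((t + c + d).choose d : ℝ) ≤
        (M : ℝ) * ((t + (c + c') + d).choose d : ℝ) := by
      rw [← Nat.cast_sub hNM]
      exact_mod_cast h4
    simp only
    rw [← mul_div_assoc, ← mul_div_assoc, ← sub_div, mul_left_comm, mul_left_comm ((M : ℝ) - N),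
      ← mul_sub]
    gcongr
    linarith

end Limits

/-! ### Hilbert function and rank over a polynomial ring -/

section Rank

variable {K : Type*} [Field K] {d : ℕ}

/-- Linear combinations of the `v i` with polynomial coefficients of degree at most `t`. -/
def boundedCombination {Q ι : Type*} [Fintype ι] [AddCommGroup Q]
    [Module (MvPolynomial (Fin d) K) Q] [Module K Q]
    [IsScalarTower K (MvPolynomial (Fin d) K) Q] (v : ι → Q) (t : ℕ) :
    (ι → restrictTotalDegree (Fin d) K t) →ₗ[K] Q :=
  (Fintype.linearCombination (MvPolynomial (Fin d) K) v).restrictScalars K ∘ₗ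
    (restrictTotalDegree (Fin d) K t).subtype.compLeft ι

lemma boundedCombination_apply {Q ι : Type*} [Fintype ι] [AddCommGroup Q]
    [Module (MvPolynomial (Fin d) K) Q] [Module K Q]
    [IsScalarTower K (MvPolynomial (Fin d) K) Q] (v : ι → Q) (t : ℕ)
    (p : ι → restrictTotalDegree (Fin d) K t) :
    boundedCombination v t p = ∑ i, (p i : MvPolynomial (Fin d) K) • v i := rfl

lemma boundedCombination_injective {Q ι : Type*} [Fintype ι] [AddCommGroup Q]
    [Module (MvPolynomial (Fin d) K) Q] [Module K Q]
    [IsScalarTower K (MvPolynomial (Fin d) K) Q] {v : ι → Q}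
    (hv : LinearIndependent (MvPolynomial (Fin d) K) v) (t : ℕ) :
    Function.Injective (boundedCombination (K := K) (d := d) v t) := by
  rw [← LinearMap.ker_eq_bot, LinearMap.ker_eq_bot']
  intro p hp
  rw [boundedCombination_apply] at hp
  have h := Fintype.linearIndependent_iff.1 hv _ hp
  funext i
  exact Subtype.ext (h i)

lemma finrank_pi_restrictTotalDegree (ι : Type*) [Fintype ι] (t : ℕ) :
    Module.finrank K (ι → restrictTotalDegree (Fin d) K t) =
      Fintype.card ι * (t + d).choose d := by
  rw [Module.finrank_pi_fintype]
  simp [finrank_restrictTotalDegree]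

variable {A : Type*} [CommRing A] [Algebra K A] [Algebra (MvPolynomial (Fin d) K) A]
  [IsScalarTower K (MvPolynomial (Fin d) K) A]

lemma linSpan_pow_mul_le_range (V : Submodule K A) {ι : Type*} [Fintype ι]
    (b : Module.Basis ι K V) (t : ℕ) :
    linSpan K (fun l => algebraMap (MvPolynomial (Fin d) K) A (X l)) ^ t * V ≤
      LinearMap.range (boundedCombination (K := K) (d := d) (fun i => (b i : A)) t) := by
  rw [Submodule.mul_le]
  intro z hz v hv
  obtain ⟨p, hp, rfl⟩ := exists_of_mem_linSpan_pow _ hz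
  have h1 : aeval (fun l => algebraMap (MvPolynomial (Fin d) K) A (X l)) p =
      algebraMap (MvPolynomial (Fin d) K) A p :=
    (AlgHom.congr_fun (aeval_unique (IsScalarTower.toAlgHom K (MvPolynomial (Fin d) K) A)) p).symm
  rw [h1]
  have hp' : p ∈ restrictTotalDegree (Fin d) K t := (mem_restrictTotalDegree _ _ _).2 hp
  refine ⟨fun i => b.repr ⟨v, hv⟩ i • ⟨p, hp'⟩, ?_⟩
  rw [boundedCombination_apply]
  have h2 := congrArg Subtype.val (b.sum_repr ⟨v, hv⟩)
  rw [Submodule.coe_sum] at h2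
  change _ = v at h2
  conv_rhs => rw [← h2, Finset.mul_sum]
  refine Finset.sum_congr rfl fun i _ => ?_
  rw [Submodule.coe_smul, Submodule.coe_smul, mul_smul_comm, smul_assoc, Algebra.smul_def p]

variable {V : Submodule K A} [Module.Finite K V] {e : ℕ}

lemma finite_of_pow_le (hgen : ∀ a : A, ∃ t, a ∈ V ^ t) (hV : 1 ≤ V)
    (hVe : ∀ t, V ^ (e + t) ≤
      linSpan K (fun l => algebraMap (MvPolynomial (Fin d) K) A (X l)) ^ t * V ^ e) :
    Module.Finite (MvPolynomial (Fin d) K) A := by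
  let b := Module.finBasis K ↥(V ^ e)
  refine ⟨Submodule.fg_def.2 ⟨Set.range fun i => (b i : A), Set.finite_range _, ?_⟩⟩
  rw [eq_top_iff]
  intro a _
  obtain ⟨t, ht⟩ := hgen a
  have h1 : a ∈ V ^ (e + t) := pow_le_pow_right₀ hV (Nat.le_add_left _ _) ht
  obtain ⟨p, hp⟩ := linSpan_pow_mul_le_range (V ^ e) b t (hVe t h1)
  rw [← hp, boundedCombination_apply]
  refine Submodule.sum_mem _ fun i _ => Submodule.smul_mem _ _ (Submodule.subset_span ⟨i, rfl⟩)

/-- The Hilbert function of a filtered algebra that is finite over a polynomial ring with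
compatible filtration grows like that of a free module of the same rank. -/
theorem tendsto_finrank_pow (hgen : ∀ a : A, ∃ t, a ∈ V ^ t) (hV : 1 ≤ V)
    (hY : ∀ l, algebraMap (MvPolynomial (Fin d) K) A (X l) ∈ V)
    (hVe : ∀ t, V ^ (e + t) ≤
      linSpan K (fun l => algebraMap (MvPolynomial (Fin d) K) A (X l)) ^ t * V ^ e) :
    Filter.Tendsto (fun t : ℕ => (d.factorial : ℝ) *
      (Module.finrank K (V ^ t : Submodule K A) : ℝ) / (t : ℝ) ^ d) Filter.atTop
      (nhds (Module.finrank (MvPolynomial (Fin d) K) A : ℝ)) := by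
  have hfin := finite_of_pow_le hgen hV hVe
  set R := MvPolynomial (Fin d) K with hR
  have hmono : Monotone fun t => V ^ t := fun _ _ h => pow_le_pow_right₀ hV h
  let b := Module.finBasis K ↥(V ^ e)
  set M := Module.finrank K ↥(V ^ e)
  set N := Module.finrank R A
  let π : (Fin M → R) →ₗ[R] A := Fintype.linearCombination R (fun i => (b i : A))
  have hπ : LinearMap.range π = ⊤ := by
    rw [eq_top_iff]
    intro a _
    obtain ⟨t, ht⟩ := hgen a
    obtain ⟨p, hp⟩ := linSpan_pow_mul_le_range (V ^ e) b t
      (hVe t (hmono (Nat.le_add_left t e) ht))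
    exact ⟨fun i => p i, hp⟩
  -- A `K`-basis of `V ^ e` gives `M` generators of `A` over `R`. Additivity of rank shows that
  -- their relations have rank exactly `M - N`.
  have hker : N + Module.finrank R (LinearMap.ker π) = M := by
    have h1 := (LinearMap.ker π).finrank_quotient_add_finrank
    rwa [(π.quotKerEquivOfSurjective (LinearMap.range_eq_top.1 hπ)).finrank_eq,
      Module.finrank_fin_fun] at h1
  obtain ⟨v, hv⟩ := exists_linearIndependent_of_le_finrank (le_refl (Module.finrank R A))
  obtain ⟨w, hw⟩ := exists_linearIndependent_of_le_finrank
    (le_refl (Module.finrank R (LinearMap.ker π)))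
  have hpowmem : ∀ t (p : R), p.totalDegree ≤ t → algebraMap R A p ∈ V ^ t := by
    intro t p hp
    have h1 : aeval (fun l => algebraMap R A (X l)) p = algebraMap R A p :=
      (AlgHom.congr_fun (aeval_unique (IsScalarTower.toAlgHom K R A)) p).symm
    rw [← h1]
    exact pow_le_pow_left' (linSpan_le (Submodule.one_le.1 hV) hY) t (aeval_mem_linSpan_pow _ hp)
  obtain ⟨c, hc⟩ : ∃ c, ∀ i, v i ∈ V ^ c := by
    choose c hc using fun i => hgen (v i)
    exact ⟨Finset.univ.sup c, fun i => hmono (Finset.le_sup (Finset.mem_univ i)) (hc i)⟩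
  obtain ⟨c', hc'⟩ : ∃ c', ∀ j i, ((w j : Fin M → R) i).totalDegree ≤ c' := by
    refine ⟨Finset.univ.sup fun j => Finset.univ.sup fun i =>
      ((w j : Fin M → R) i).totalDegree, fun j i => ?_⟩
    refine le_trans ?_ (Finset.le_sup (f := fun j => Finset.univ.sup fun i =>
      ((w j : Fin M → R) i).totalDegree) (Finset.mem_univ j))
    exact Finset.le_sup (f := fun i => ((w j : Fin M → R) i).totalDegree) (Finset.mem_univ i)
  refine tendsto_of_choose_bounds (M := M) (c := c) (c' := c' + e) (by omega) ?_ ?_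
  · intro t
    have h1 := boundedCombination_injective (K := K) hv t
    have h2 : LinearMap.range (boundedCombination (K := K) (d := d) v t) ≤ V ^ (t + c) := by
      rintro _ ⟨p, rfl⟩
      rw [boundedCombination_apply]
      refine Submodule.sum_mem _ fun i _ => ?_
      rw [Algebra.smul_def, pow_add]
      exact Submodule.mul_mem_mul (hpowmem _ _ ((mem_restrictTotalDegree _ _ _).1 (p i).2)) (hc i)
    have h3 := Submodule.finrank_mono h2
    rw [LinearMap.finrank_range_of_inj h1, finrank_pi_restrictTotalDegree, Fintype.card_fin] at h3
    exact h3
  · intro t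
    let g := boundedCombination (K := K) (d := d) (fun i => (b i : A)) (t + c')
    have h1 := LinearMap.finrank_range_add_finrank_ker g
    rw [finrank_pi_restrictTotalDegree, Fintype.card_fin] at h1
    have h2 : Module.finrank K ↥(V ^ (t + (c' + e))) ≤ Module.finrank K (LinearMap.range g) := by
      refine Submodule.finrank_mono ?_
      rw [show t + (c' + e) = e + (t + c') by ring]
      exact (hVe _).trans (linSpan_pow_mul_le_range (V ^ e) b _)
    -- Multiplying the independent relations `w j`, of degree at most `c'`, by polynomials of degree
    -- at most `t` gives that many relations among coefficients of degree at most `t + c'`.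
    have h3 : (M - N) * (t + d).choose d ≤ Module.finrank K (LinearMap.ker g) := by
      rw [show M - N = Module.finrank R (LinearMap.ker π) by omega]
      have hdeg : ∀ (p : Fin (Module.finrank R (LinearMap.ker π)) →
          restrictTotalDegree (Fin d) K t) i,
          (∑ j, (p j : R) * (w j : Fin M → R) i) ∈ restrictTotalDegree (Fin d) K (t + c') := by
        intro p i
        refine Submodule.sum_mem _ fun j _ => (mem_restrictTotalDegree _ _ _).2 ?_
        exact (totalDegree_mul _ _).trans
          (add_le_add ((mem_restrictTotalDegree _ _ _).1 (p j).2) (hc' j i))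
      have happ : ∀ (p : Fin (Module.finrank R (LinearMap.ker π)) →
          restrictTotalDegree (Fin d) K t) i,
          ((boundedCombination (K := K) w t p : LinearMap.ker π) : Fin M → R) i =
            ∑ j, (p j : R) * (w j : Fin M → R) i := by
        intro p i
        rw [boundedCombination_apply, Submodule.coe_sum, Finset.sum_apply]
        rfl
      let h : (Fin (Module.finrank R (LinearMap.ker π)) → restrictTotalDegree (Fin d) K t) →ₗ[K]
          (Fin M → restrictTotalDegree (Fin d) K (t + c')) :=
        LinearMap.pi fun i => LinearMap.codRestrict _
          (LinearMap.proj i ∘ₗ ((LinearMap.ker π).subtype.restrictScalars K) ∘ₗ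
            boundedCombination (K := K) w t) (fun p => by
              have := hdeg p i
              rw [← happ] at this
              exact this)
      have hh : ∀ p i, ((h p i : restrictTotalDegree (Fin d) K (t + c')) : R) =
          ((boundedCombination (K := K) w t p : LinearMap.ker π) : Fin M → R) i := fun _ _ => rfl
      have hk : ∀ p, h p ∈ LinearMap.ker g := by
        intro p
        rw [LinearMap.mem_ker]
        have h4 := (boundedCombination (K := K) w t p).2
        rw [LinearMap.mem_ker] at h4
        exact h4
      have hinj : Function.Injective (LinearMap.codRestrict _ h hk) := by
        intro p q hpq
        apply boundedCombination_injective (K := K) hw t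
        apply Subtype.ext
        funext i
        rw [← hh, ← hh]
        exact congrArg (fun z : LinearMap.ker g => ((z.1 i : restrictTotalDegree (Fin d) K _) : R)) hpq
      have h5 := LinearMap.finrank_le_finrank_of_injective hinj
      rwa [finrank_pi_restrictTotalDegree, Fintype.card_fin] at h5
    rw [show t + (c' + e) + d = t + c' + e + d by ring]
    have h4 : M * (t + c' + d).choose d ≤ M * (t + c' + e + d).choose d :=
      Nat.mul_le_mul_left _ (Nat.choose_le_choose _ (by omega))
    omega

end Rank

/-! ### Spreading out from the generic fibre -/

section Spreading

open TensorProduct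

variable {S B : Type*} [CommRing S] [CommRing B] [Algebra S B]

lemma exists_smul_mem_span_of_basis [IsDomain S] {Q ι : Type*} [Field Q] [Algebra S Q]
    [IsFractionRing S Q] [Fintype ι] (b : ι → B) (hspan : Submodule.span Q (Set.range fun i => (1 : Q) ⊗ₜ[S] b i) = ⊤)
    (β : B) : ∃ s : S, s ≠ 0 ∧ s • β ∈ Submodule.span S (Set.range b) := by
  have h1 : (1 : Q) ⊗ₜ[S] β ∈ Submodule.span Q (Set.range fun i => (1 : Q) ⊗ₜ[S] b i) := by
    rw [hspan]; trivial
  obtain ⟨q, hq⟩ := (Submodule.mem_span_range_iff_exists_fun Q).1 h1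
  obtain ⟨s, hs⟩ := IsLocalization.exist_integer_multiples_of_finite (nonZeroDivisors S) q
  choose c hc using hs
  have h2 : (TensorProduct.mk S Q B 1) ((s : S) • β) =
      (TensorProduct.mk S Q B 1) (∑ i, c i • b i) := by
    rw [map_smul, map_sum, TensorProduct.mk_apply, ← hq, Finset.smul_sum]
    refine Finset.sum_congr rfl fun i _ => ?_
    rw [map_smul, TensorProduct.mk_apply, ← smul_assoc, ← hc i, algebraMap_smul]
  obtain ⟨t, ht⟩ := IsLocalizedModule.exists_of_eq (S := nonZeroDivisors S) h2
  refine ⟨t * s, mul_ne_zero (nonZeroDivisors.ne_zero t.2) (nonZeroDivisors.ne_zero s.2), ?_⟩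
  rw [mul_smul]
  change (t : S) • (s : S) • β = (t : S) • ∑ i, c i • b i at ht
  rw [ht]
  refine Submodule.smul_mem _ _ (Submodule.sum_mem _ fun i _ => Submodule.smul_mem _ _ ?_)
  exact Submodule.subset_span ⟨i, rfl⟩

lemma exists_smul_mem_of_finset [IsDomain S] {M : Submodule S B}
    (hM : ∀ β : B, ∃ s : S, s ≠ 0 ∧ s • β ∈ M) (Y : Finset B) :
    ∃ s : S, s ≠ 0 ∧ ∀ β ∈ Y, s • β ∈ M := by
  classical
  induction Y using Finset.induction_on with
  | empty => exact ⟨1, one_ne_zero, by simp⟩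
  | insert a Y _ ih =>
    obtain ⟨s, hs, h⟩ := ih
    obtain ⟨s', hs', h'⟩ := hM a
    refine ⟨s * s', mul_ne_zero hs hs', fun β hβ => ?_⟩
    rcases Finset.mem_insert.1 hβ with rfl | hβ
    · rw [mul_smul]; exact M.smul_mem _ h'
    · rw [mul_comm, mul_smul]; exact M.smul_mem _ (h β hβ)

/-- A finitely generated algebra over a domain whose generic fibre is finite becomes free of finite
rank after inverting one nonzero element. -/
lemma exists_free_localizationAway [IsDomain S] (Q : Type*) [Field Q] [Algebra S Q]
    [IsFractionRing S Q]
    [Algebra.FiniteType S B] [Module.Finite Q (Q ⊗[S] B)] :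
    ∃ s : S, s ≠ 0 ∧ Module.Finite (Localization.Away s) (Localization.Away s ⊗[S] B) ∧
      Module.Free (Localization.Away s) (Localization.Away s ⊗[S] B) := by
  classical
  -- The basis of the generic fibre is chosen among the `1 ⊗ β`, so that it already lives in `B`.
  obtain ⟨T, hTs, hTspan, hTli⟩ := exists_linearIndependent Q
    (Set.range fun β : B => (1 : Q) ⊗ₜ[S] β)
  have hTop : Submodule.span Q T = ⊤ := by
    rw [hTspan, eq_top_iff]
    intro x _
    induction x using TensorProduct.induction_on with
    | zero => exact Submodule.zero_mem _
    | add x y hx hy => exact Submodule.add_mem _ (hx trivial) (hy trivial)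
    | tmul q β =>
      rw [show q ⊗ₜ[S] β = q • ((1 : Q) ⊗ₜ[S] β) by rw [smul_tmul', smul_eq_mul, mul_one]]
      exact Submodule.smul_mem _ _ (Submodule.subset_span ⟨β, rfl⟩)
  have : Finite T := hTli.finite
  have : Fintype T := Fintype.ofFinite T
  choose b hb using fun x : T => hTs x.2
  have hb' : (fun i => (1 : Q) ⊗ₜ[S] b i) = ((↑) : T → Q ⊗[S] B) := funext hb
  have hrel := exists_smul_mem_span_of_basis (Q := Q) b (by
    rw [hb', Subtype.range_coe, hTop])
  obtain ⟨G, hG⟩ := Algebra.FiniteType.out (R := S) (A := B)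
  -- Finitely many denominators suffice: once `1` and all products of an algebra generator with a
  -- basis element lie in the span, the span is stable under multiplication by `B` and hence
  -- everything.
  obtain ⟨s, hs, hsY⟩ := exists_smul_mem_of_finset hrel
    (insert 1 ((G ×ˢ Finset.univ).image fun p : B × T => p.1 * b p.2))
  refine ⟨s, hs, ?_⟩
  set L := Localization.Away s
  have hpow : Submonoid.powers s ≤ nonZeroDivisors S :=
    powers_le_nonZeroDivisors_of_noZeroDivisors hs
  let _ : Algebra L Q := IsLocalization.localizationAlgebraOfSubmonoidLe L Q _ _ hpow
  have : IsScalarTower S L Q := IsLocalization.localization_isScalarTower_of_submonoid_le L Q _ _ hpow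
  have hLQ : Function.Injective (algebraMap L Q) := by
    have h2 : IsFractionRing L Q :=
      IsFractionRing.isFractionRing_of_isDomain_of_isLocalization (Submonoid.powers s) L Q
    exact IsFractionRing.injective L Q
  let v : T → L ⊗[S] B := fun i => 1 ⊗ₜ b i
  have hli : LinearIndependent L v := by
    rw [Fintype.linearIndependent_iff]
    intro a ha i
    have h1 := congrArg (LinearMap.rTensor B ((IsScalarTower.toAlgHom S L Q).toLinearMap)) ha
    rw [map_sum, map_zero] at h1
    have h2 : ∑ i, algebraMap L Q (a i) • (i : Q ⊗[S] B) = 0 := by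
      rw [← h1]
      refine Finset.sum_congr rfl fun i _ => ?_
      rw [← hb, show a i • v i = a i ⊗ₜ[S] b i by rw [smul_tmul', smul_eq_mul, mul_one]]
      rw [LinearMap.rTensor_tmul]
      change algebraMap L Q (a i) • ((1 : Q) ⊗ₜ[S] b i) = _
      rw [smul_tmul', smul_eq_mul, mul_one]
      rfl
    exact hLQ (by rw [map_zero]; exact Fintype.linearIndependent_iff.1 hTli _ h2 i)
  have hunit : ∀ β : B, s • β ∈ Submodule.span S (Set.range b) →
      (1 : L) ⊗ₜ[S] β ∈ Submodule.span L (Set.range v) := by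
    intro β hβ
    have h1 : ∀ x ∈ Submodule.span S (Set.range b),
        (1 : L) ⊗ₜ[S] x ∈ Submodule.span L (Set.range v) := by
      intro x hx
      induction hx using Submodule.span_induction with
      | mem x hx =>
        obtain ⟨i, rfl⟩ := hx
        exact Submodule.subset_span ⟨i, rfl⟩
      | zero => rw [tmul_zero]; exact Submodule.zero_mem _
      | add x y _ _ hx hy => rw [tmul_add]; exact Submodule.add_mem _ hx hy
      | smul c x _ hx =>
        rw [tmul_smul, ← algebraMap_smul L c]
        exact Submodule.smul_mem _ _ hx
    have h3 := h1 _ hβ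
    rw [tmul_smul, ← algebraMap_smul L s] at h3
    obtain ⟨w, hw⟩ := IsLocalization.map_units L (⟨s, Submonoid.mem_powers s⟩ : Submonoid.powers s)
    have h2 := Submodule.smul_mem _ ((w⁻¹ : Lˣ) : L) h3
    rwa [← smul_assoc, smul_eq_mul, ← hw, Units.inv_mul, one_smul] at h2
  have hspan : ⊤ ≤ Submodule.span L (Set.range v) := by
    have h1 : ∀ g ∈ G, ∀ x ∈ Submodule.span L (Set.range v),
        ((1 : L) ⊗ₜ[S] g) * x ∈ Submodule.span L (Set.range v) := by
      intro g hg x hx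
      induction hx using Submodule.span_induction with
      | mem x hx =>
        obtain ⟨i, rfl⟩ := hx
        simp only [v, Algebra.TensorProduct.tmul_mul_tmul, mul_one]
        refine hunit _ (hsY _ (Finset.mem_insert_of_mem (Finset.mem_image.2 ⟨(g, i), ?_, rfl⟩)))
        simp [hg]
      | zero => rw [mul_zero]; exact Submodule.zero_mem _
      | add x y _ _ hx hy => rw [mul_add]; exact Submodule.add_mem _ hx hy
      | smul c x _ hx => rw [mul_smul_comm]; exact Submodule.smul_mem _ _ hx
    have h2 : ∀ β : B, ∀ x ∈ Submodule.span L (Set.range v),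
        ((1 : L) ⊗ₜ[S] β) * x ∈ Submodule.span L (Set.range v) := by
      intro β
      have hβ : β ∈ Algebra.adjoin S (G : Set B) := by rw [hG]; trivial
      induction hβ using Algebra.adjoin_induction with
      | mem g hg => exact h1 g hg
      | algebraMap r =>
        intro x hx
        rw [Algebra.algebraMap_eq_smul_one, tmul_smul, smul_mul_assoc,
          ← Algebra.TensorProduct.one_def, one_mul, ← algebraMap_smul L r]
        exact Submodule.smul_mem _ _ hx
      | add a c _ _ ha hc =>
        intro x hx
        rw [tmul_add, add_mul]
        exact Submodule.add_mem _ (ha x hx) (hc x hx)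
      | mul a c _ _ ha hc =>
        intro x hx
        have := ha _ (hc x hx)
        rwa [← mul_assoc, Algebra.TensorProduct.tmul_mul_tmul, mul_one] at this
    have h3 : (1 : L ⊗[S] B) ∈ Submodule.span L (Set.range v) :=
      hunit 1 (hsY 1 (Finset.mem_insert_self _ _))
    intro x _
    induction x using TensorProduct.induction_on with
    | zero => exact Submodule.zero_mem _
    | add x y hx hy => exact Submodule.add_mem _ (hx trivial) (hy trivial)
    | tmul q β =>
      rw [show q ⊗ₜ[S] β = q • ((1 : L) ⊗ₜ[S] β) by rw [smul_tmul', smul_eq_mul, mul_one]]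
      have := h2 β 1 h3
      rw [mul_one] at this
      exact Submodule.smul_mem _ _ this
  let bas := Module.Basis.mk hli hspan
  exact ⟨Module.Finite.of_basis bas, Module.Free.of_basis bas⟩

lemma finite_and_finrank_tensor_of_away {s : S}
    [Module.Finite (Localization.Away s) (Localization.Away s ⊗[S] B)]
    [Module.Free (Localization.Away s) (Localization.Away s ⊗[S] B)]
    (k : Type*) [Field k] [Algebra S k] (hs : algebraMap S k s ≠ 0) :
    Module.Finite k (k ⊗[S] B) ∧ Module.finrank k (k ⊗[S] B) =
      Module.finrank (Localization.Away s) (Localization.Away s ⊗[S] B) := by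
  set L := Localization.Away s
  let f : L →+* k := IsLocalization.Away.lift s (g := algebraMap S k) (isUnit_iff_ne_zero.2 hs)
  let _ : Algebra L k := f.toAlgebra
  have : Nontrivial L := f.domain_nontrivial
  have : IsScalarTower S L k := IsScalarTower.of_algebraMap_eq fun x =>
    (IsLocalization.Away.lift_eq s (isUnit_iff_ne_zero.2 hs) x).symm
  let e := TensorProduct.AlgebraTensorModule.cancelBaseChange S L k k B
  refine ⟨Module.Finite.equiv e, ?_⟩
  rw [← e.finrank_eq, Module.finrank_baseChange]

/-- The rank of a vector space is unchanged by field extension, so finiteness descends from `F` to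
the fraction field. -/
lemma finite_tensor_fractionRing [IsDomain S] (F : Type*) [Field F] [Algebra S F]
    [FaithfulSMul S F] [Module.Finite F (F ⊗[S] B)] :
    Module.Finite (FractionRing S) (FractionRing S ⊗[S] B) := by
  let _ : Algebra (FractionRing S) F := FractionRing.liftAlgebra S F
  have : IsScalarTower S (FractionRing S) F := FractionRing.isScalarTower_liftAlgebra S F
  let e := TensorProduct.AlgebraTensorModule.cancelBaseChange S (FractionRing S) F F B
  have h1 : Module.Finite F (F ⊗[FractionRing S] (FractionRing S ⊗[S] B)) :=
    Module.Finite.equiv e.symm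
  rw [← Module.rank_lt_aleph0_iff] at h1 ⊢
  rwa [Module.rank_baseChange, Cardinal.lift_lt_aleph0] at h1

/-- After inverting `s` the algebra is free of finite rank, and both `F` and each `k` in which `s`
is nonzero are base changes from there. The field `F` may be larger than the fraction field. -/
theorem exists_ne_zero_forall_finrank_tensor [IsDomain S] (F : Type*) [Field F] [Algebra S F]
    [FaithfulSMul S F] [Algebra.FiniteType S B] [Module.Finite F (F ⊗[S] B)] :
    ∃ s : S, s ≠ 0 ∧ ∀ (k : Type*) [Field k] [Algebra S k], algebraMap S k s ≠ 0 →
      Module.Finite k (k ⊗[S] B) ∧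
        Module.finrank k (k ⊗[S] B) = Module.finrank F (F ⊗[S] B) := by
  have := finite_tensor_fractionRing (B := B) F (S := S)
  obtain ⟨s, hs, _, _⟩ := exists_free_localizationAway (S := S) (B := B) (FractionRing S)
  refine ⟨s, hs, fun k _ _ hk => ?_⟩
  have h1 := finite_and_finrank_tensor_of_away (B := B) k hk
  have h2 := finite_and_finrank_tensor_of_away (B := B) F
    (s := s) (by rwa [Ne, FaithfulSMul.algebraMap_eq_zero_iff])
  exact ⟨h1.1, h1.2.trans h2.2.symm⟩

end Spreading

/-! ### Torsion-freeness after base change -/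

section TorsionFree

open TensorProduct

/-- By flatness of `R'`, `R' ⊗ A` embeds into `R' ⊗ Frac A`. As `Frac A` is flat over `R`, the
latter is flat over the domain `R'`, hence torsion-free. -/
lemma eq_zero_of_smul_tensor_eq_zero {R R' A : Type*} [CommRing R] [IsDomain R] [CommRing R']
    [IsDomain R'] [CommRing A] [IsDomain A] [Algebra R R'] [Algebra R A] [FaithfulSMul R A]
    [Module.Flat R R'] {w : R'} (hw : w ≠ 0) {t : R' ⊗[R] A} (h : w • t = 0) : t = 0 := by
  let Q := FractionRing R
  let L := FractionRing A
  have : FaithfulSMul R L := FaithfulSMul.trans R A L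
  let _ : Algebra Q L := FractionRing.liftAlgebra R L
  have : IsScalarTower R Q L := FractionRing.isScalarTower_liftAlgebra R L
  have : Module.Flat R Q := IsLocalization.flat Q (nonZeroDivisors R)
  have : Module.Flat R L := Module.Flat.trans R Q L
  let f : A →ₗ[R] L := (IsScalarTower.toAlgHom R A L).toLinearMap
  have hf : Function.Injective f := IsFractionRing.injective A L
  have hinj : Function.Injective (f.baseChange R') :=
    Module.Flat.lTensor_preserves_injective_linearMap f hf
  apply hinj
  rw [map_zero]
  have h1 : w • f.baseChange R' t = 0 := by rw [← map_smul, h, map_zero]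
  exact (smul_eq_zero.1 h1).resolve_left hw

variable {k E : Type*} [Field k] [Field E] [Algebra k E] {n d : ℕ}

/-- The map from `E[x]` to the base change from `k[z]` to `E[z]` of a quotient `A` of `k[x]`. -/
lemma exists_ringHom_tensor {A A' : Type*} [CommRing A] [CommRing A']
    (π : MvPolynomial (Fin n) k →+* A) (γ : MvPolynomial (Fin n) E →+* A') (β : A →+* A')
    (hβ : β.comp π = γ.comp (MvPolynomial.map (algebraMap k E)))
    (z : Fin d → MvPolynomial (Fin n) k) [Algebra (MvPolynomial (Fin d) k) (MvPolynomial (Fin d) E)]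
    [Algebra (MvPolynomial (Fin d) k) A]
    (hE : algebraMap (MvPolynomial (Fin d) k) (MvPolynomial (Fin d) E) =
      MvPolynomial.map (algebraMap k E))
    (hA : algebraMap (MvPolynomial (Fin d) k) A = π.comp (aeval z).toRingHom) :
    ∃ Λ : MvPolynomial (Fin n) E →+* MvPolynomial (Fin d) E ⊗[MvPolynomial (Fin d) k] A,
      (∀ w : MvPolynomial (Fin d) E,
        Λ (aeval (fun l => MvPolynomial.map (algebraMap k E) (z l)) w) = w ⊗ₜ 1) ∧
      (∀ f, Λ (MvPolynomial.map (algebraMap k E) f) = 1 ⊗ₜ π f) ∧ ∀ b, Λ b = 0 → γ b = 0 := by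
  set R := MvPolynomial (Fin d) k
  set R' := MvPolynomial (Fin d) E
  let Λ : MvPolynomial (Fin n) E →+* R' ⊗[R] A :=
    eval₂Hom ((Algebra.TensorProduct.includeLeftRingHom : R' →+* R' ⊗[R] A).comp C)
      (fun i => 1 ⊗ₜ π (X i))
  have hΛmap : Λ.comp (MvPolynomial.map (algebraMap k E)) =
      (Algebra.TensorProduct.includeRight : A →ₐ[R] R' ⊗[R] A).toRingHom.comp π := by
    apply MvPolynomial.ringHom_ext
    · intro c
      simp only [RingHom.comp_apply, map_C, Λ, coe_eval₂Hom, eval₂_C]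
      have h1 : (C (algebraMap k E c) : R') = algebraMap R R' (C c) := by rw [hE, map_C]
      have h2 : π (C c) = algebraMap R A (C c) := by
        rw [hA]; change π (C c) = π (aeval z (C c)); rw [aeval_C]; rfl
      rw [h1, h2]
      exact Algebra.TensorProduct.algebraMap_apply' (C c)
    · intro i
      simp [Λ]
  let _ : Algebra R A' := ((γ.comp (MvPolynomial.map (algebraMap k E))).comp
      (aeval z).toRingHom).toAlgebra
  have hz : (aeval (fun l => MvPolynomial.map (algebraMap k E) (z l)) :
        R' →ₐ[E] MvPolynomial (Fin n) E).toRingHom.comp (MvPolynomial.map (algebraMap k E)) =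
      (MvPolynomial.map (algebraMap k E)).comp (aeval z).toRingHom := by
    apply MvPolynomial.ringHom_ext
    · intro c; simp [algebraMap_eq]
    · intro i; simp
  let α : R' →ₐ[R] A' :=
    { toRingHom := γ.comp (aeval (fun l => MvPolynomial.map (algebraMap k E) (z l))).toRingHom
      commutes' := by
        intro f
        rw [hE]
        exact congrArg γ (RingHom.congr_fun hz f) }
  let β' : A →ₐ[R] A' :=
    { toRingHom := β
      commutes' := by
        intro f
        rw [hA]
        exact RingHom.congr_fun hβ (aeval z f) }
  let Ψ := Algebra.TensorProduct.lift α β' (fun _ _ => Commute.all _ _)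
  have hΨΛ : Ψ.toRingHom.comp Λ = γ := by
    apply MvPolynomial.ringHom_ext
    · intro c
      have : α (C c) = γ (C c) := by
        change γ (aeval _ (C c)) = _
        simp [algebraMap_eq]
      simp [Ψ, Λ, this]
    · intro i
      have := RingHom.congr_fun hβ (X i)
      simp only [RingHom.comp_apply, map_X] at this
      simp [Ψ, Λ, β', this]
  refine ⟨Λ, ?_, ?_, ?_⟩
  · intro w
    have h : Λ.comp (aeval (fun l => MvPolynomial.map (algebraMap k E) (z l))).toRingHom =
        (Algebra.TensorProduct.includeLeftRingHom : R' →+* R' ⊗[R] A) := by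
      apply MvPolynomial.ringHom_ext
      · intro c
        simp [Λ, algebraMap_eq]
      · intro l
        have h1 := RingHom.congr_fun hΛmap (z l)
        have h2 : π (z l) = algebraMap R A (X l) := by
          rw [hA]; change π (z l) = π (aeval z (X l)); rw [aeval_X]
        have h3 : (X l : R') = algebraMap R R' (X l) := by rw [hE, map_X]
        simp only [RingHom.comp_apply, AlgHom.toRingHom_eq_coe, RingHom.coe_coe, aeval_X] at h1 ⊢
        rw [h1, h2, h3]
        exact (Algebra.TensorProduct.algebraMap_apply' (X l)).symm
    exact RingHom.congr_fun h w
  · exact RingHom.congr_fun hΛmap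
  · intro b hb
    rw [← hΨΛ, RingHom.comp_apply, hb, map_zero]

/-- The quotient `E[x] / p E[x]` is the base change of `k[x] / p` from `k[z]` to `E[z]`, hence
torsion-free over `E[z]`, although `p E[x]` need not be prime. -/
lemma mem_extIdeal_of_aeval_mul_mem {p : Ideal (MvPolynomial (Fin n) k)} [hp : p.IsPrime]
    {z : Fin d → MvPolynomial (Fin n) k} (hz : ∀ f : MvPolynomial (Fin d) k, aeval z f ∈ p → f = 0)
    {w : MvPolynomial (Fin d) E} (hw : w ≠ 0) {b : MvPolynomial (Fin n) E}
    (h : aeval (fun l => MvPolynomial.map (algebraMap k E) (z l)) w * b ∈ extIdeal E p) :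
    b ∈ extIdeal E p := by
  let _ : Algebra (MvPolynomial (Fin d) k) (MvPolynomial (Fin d) E) :=
    MvPolynomial.algebraMvPolynomial
  have : Module.Flat (MvPolynomial (Fin d) k) (MvPolynomial (Fin d) E) := by
    have := Algebra.IsPushout.out (R := k) (S := MvPolynomial (Fin d) k) (R' := E)
      (S' := MvPolynomial (Fin d) E)
    exact Module.Flat.isBaseChange _ _ _ _ this
  obtain ⟨A, _, _, π, hπ, β, hβ⟩ : ∃ (A : Type _) (_ : CommRing A) (_ : IsDomain A)
      (π : MvPolynomial (Fin n) k →+* A) (_ : ∀ f, π f = 0 ↔ f ∈ p)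
      (β : A →+* (MvPolynomial (Fin n) E ⧸ extIdeal E p)),
      β.comp π = (Ideal.Quotient.mk (extIdeal E p)).comp (MvPolynomial.map (algebraMap k E)) :=
    ⟨_, inferInstance, inferInstance, Ideal.Quotient.mk p,
      fun _ => Ideal.Quotient.eq_zero_iff_mem,
      Ideal.quotientMap (extIdeal E p) (MvPolynomial.map (algebraMap k E)) Ideal.le_comap_map, by
        exact RingHom.ext fun _ => rfl⟩
  let _ : Algebra (MvPolynomial (Fin d) k) A := (π.comp (aeval z).toRingHom).toAlgebra
  obtain ⟨Λ, hΛ1, hΛ2, hΛ3⟩ := exists_ringHom_tensor π (Ideal.Quotient.mk (extIdeal E p)) β hβ z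
    rfl rfl
  have : FaithfulSMul (MvPolynomial (Fin d) k) A := by
    rw [faithfulSMul_iff_algebraMap_injective, injective_iff_map_eq_zero]
    intro f hf
    exact hz f ((hπ _).1 hf)
  rw [← Ideal.Quotient.eq_zero_iff_mem]
  apply hΛ3
  refine eq_zero_of_smul_tensor_eq_zero hw ?_
  have h1 : extIdeal E p ≤ RingHom.ker Λ := by
    rw [extIdeal, Ideal.map_le_iff_le_comap]
    intro f hf
    rw [Ideal.mem_comap, RingHom.mem_ker, hΛ2, (hπ f).2 hf, tmul_zero]
  have h2 := RingHom.mem_ker.1 (h1 h)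
  rw [map_mul, hΛ1] at h2
  rw [← h2, Algebra.smul_def]
  rfl

end TorsionFree

/-! ### Noether normalizations and primes over a field extension -/

section NoetherLift

variable {k E : Type*} [Field k] [Field E] [Algebra k E] {n d : ℕ}

lemma ringKrullDim_mvPolynomial_fin : ringKrullDim (MvPolynomial (Fin n) k) = n := by
  rw [MvPolynomial.ringKrullDim_of_isNoetherianRing, ringKrullDim_eq_zero_of_field, zero_add,
    Nat.card_fin]

lemma exists_ringKrullDim_eq {J : Ideal (MvPolynomial (Fin n) k)} (hJ : J ≠ ⊤) :
    ∃ d : ℕ, ringKrullDim (MvPolynomial (Fin n) k ⧸ J) = d := by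
  have : Nontrivial (MvPolynomial (Fin n) k ⧸ J) := Ideal.Quotient.nontrivial_iff.2 hJ
  have h1 := ringKrullDim_quotient_le J
  rw [ringKrullDim_mvPolynomial_fin] at h1
  have h2 : (0 : WithBot ℕ∞) ≤ ringKrullDim (MvPolynomial (Fin n) k ⧸ J) :=
    ringKrullDim_nonneg_of_nontrivial
  generalize ringKrullDim (MvPolynomial (Fin n) k ⧸ J) = D at h1 h2
  induction D with
  | bot => simp at h2
  | coe D =>
    induction D with
    | top =>
      exfalso
      have h3 : (⊤ : ℕ∞) ≤ (n : ℕ∞) := by exact_mod_cast h1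
      simp at h3
    | coe D => exact ⟨D, rfl⟩

lemma le_ringKrullDim_of_algebraicIndependent {J : Ideal (MvPolynomial (Fin n) k)}
    {z : Fin d → MvPolynomial (Fin n) k ⧸ J} (hz : AlgebraicIndependent k z) :
    (d : WithBot ℕ∞) ≤ ringKrullDim (MvPolynomial (Fin n) k ⧸ J) := by
  have hJ : J ≠ ⊤ := by
    rintro rfl
    exact one_ne_zero (α := MvPolynomial (Fin d) k) (hz (Subsingleton.elim _ _))
  obtain ⟨D, hD⟩ := exists_ringKrullDim_eq hJ
  obtain ⟨C, hC⟩ := affineHilbertFunction_le_of_ringKrullDim_le J hD.le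
  rw [hD]
  exact_mod_cast le_of_injective_of_affineHilbertFunction_le J hC hz

lemma algebraicIndependent_mk {J : Ideal (MvPolynomial (Fin n) k)}
    {z : Fin d → MvPolynomial (Fin n) k} (hz : ∀ f : MvPolynomial (Fin d) k, aeval z f ∈ J → f = 0) :
    AlgebraicIndependent k (fun l => Ideal.Quotient.mk J (z l)) := by
  rw [algebraicIndependent_iff]
  intro f hf
  refine hz f (Ideal.Quotient.eq_zero_iff_mem.1 ?_)
  rw [← hf, ← Ideal.Quotient.mkₐ_eq_mk k, ← comp_aeval_apply]

/-- Independent `y` would force the Hilbert function of the extended ideal to grow with order at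
least `d`, but it equals that of `J`. The `y` need not be defined over `k`. -/
lemma exists_ne_zero_aeval_mem_extIdeal {J : Ideal (MvPolynomial (Fin n) k)}
    (hJ : ringKrullDim (MvPolynomial (Fin n) k ⧸ J) < d) (y : Fin d → MvPolynomial (Fin n) E) :
    ∃ f : MvPolynomial (Fin d) E, f ≠ 0 ∧ aeval y f ∈ extIdeal E J := by
  by_cases hJtop : J = ⊤
  · refine ⟨1, one_ne_zero, ?_⟩
    rw [hJtop, extIdeal, Ideal.map_top]
    trivial
  obtain ⟨D, hD⟩ := exists_ringKrullDim_eq hJtop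
  obtain ⟨C, hC⟩ := affineHilbertFunction_le_of_ringKrullDim_le J hD.le
  by_contra! h
  have h1 := le_of_injective_of_affineHilbertFunction_le (extIdeal E J) (d := D) (C := C)
    (fun t => by rw [affineHilbertFunction_extIdeal]; exact hC t)
    (algebraicIndependent_mk (J := extIdeal E J) (z := y) fun f hf => by
      by_contra hf0
      exact h f hf0 hf)
  rw [hD] at hJ
  have h2 : D < d := by exact_mod_cast hJ
  omega

lemma exists_ne_zero_dvd_of_isIntegral {R S : Type*} [CommRing R] [Nontrivial R] [CommRing S]
    [IsDomain S] (φ : R →+* S) (hφ : φ.IsIntegral) {a : S} (ha : a ≠ 0) :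
    ∃ f : R, f ≠ 0 ∧ a ∣ φ f := by
  algebraize [φ]
  have h := Ideal.comap_ne_bot_of_integral_mem (R := R) ha (Ideal.mem_span_singleton_self a) (hφ a)
  obtain ⟨f, hf, hf0⟩ := Submodule.exists_mem_ne_zero_of_ne_bot h
  exact ⟨f, hf0, Ideal.mem_span_singleton.1 hf⟩

/-- Lifts to `k[x]` of a Noether normalization of `k[x] / p`. -/
structure IsNoetherLift (p : Ideal (MvPolynomial (Fin n) k))
    (z : Fin d → MvPolynomial (Fin n) k) : Prop where
  eq_zero : ∀ f : MvPolynomial (Fin d) k, aeval z f ∈ p → f = 0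
  isIntegral : ((Ideal.Quotient.mk p).comp
    (aeval z : MvPolynomial (Fin d) k →ₐ[k] MvPolynomial (Fin n) k).toRingHom).IsIntegral

lemma exists_isNoetherLift {p : Ideal (MvPolynomial (Fin n) k)}
    (hd : ringKrullDim (MvPolynomial (Fin n) k ⧸ p) = d) :
    ∃ z : Fin d → MvPolynomial (Fin n) k, IsNoetherLift p z := by
  have hp : p ≠ ⊤ := by
    rintro rfl
    rw [ringKrullDim_eq_bot_of_subsingleton] at hd
    exact absurd hd (by simp)
  have : Nontrivial (MvPolynomial (Fin n) k ⧸ p) := Ideal.Quotient.nontrivial_iff.2 hp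
  obtain ⟨s, φ, hφ, hfin⟩ := exists_finite_inj_algHom_of_fg k (MvPolynomial (Fin n) k ⧸ p)
  have h1 := ringKrullDim_eq_of_isIntegral φ.toRingHom hfin.to_isIntegral hφ
  rw [ringKrullDim_mvPolynomial_fin,
    hd] at h1
  obtain rfl : d = s := by exact_mod_cast h1
  choose z hz using fun l => Ideal.Quotient.mk_surjective (I := p) (φ (X l))
  have h2 : (Ideal.Quotient.mkₐ k p).comp (aeval z) = φ := by
    apply MvPolynomial.algHom_ext
    intro l
    simp [hz]
  refine ⟨z, fun f hf => ?_, ?_⟩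
  · apply hφ
    rw [map_zero, ← h2]
    exact Ideal.Quotient.eq_zero_iff_mem.2 hf
  · have h3 := congrArg AlgHom.toRingHom h2
    have h4 : φ.toRingHom.IsIntegral := hfin.to_isIntegral
    rw [← h3] at h4
    exact h4

namespace IsNoetherLift

variable {p : Ideal (MvPolynomial (Fin n) k)} {z : Fin d → MvPolynomial (Fin n) k}

lemma ringKrullDim_eq (h : IsNoetherLift p z) :
    ringKrullDim (MvPolynomial (Fin n) k ⧸ p) = d := by
  rw [ringKrullDim_eq_of_isIntegral _ h.isIntegral, ringKrullDim_mvPolynomial_fin]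
  rw [injective_iff_map_eq_zero]
  exact fun f hf => h.eq_zero f (Ideal.Quotient.eq_zero_iff_mem.1 hf)

lemma isIntegral_of_le (h : IsNoetherLift p z) {Q : Ideal (MvPolynomial (Fin n) E)}
    (hQ : extIdeal E p ≤ Q) : ((Ideal.Quotient.mk Q).comp
      (aeval (fun l => MvPolynomial.map (algebraMap k E) (z l)) :
        MvPolynomial (Fin d) E →ₐ[E] MvPolynomial (Fin n) E).toRingHom).IsIntegral := by
  set θ := (Ideal.Quotient.mk Q).comp
      (aeval (fun l => MvPolynomial.map (algebraMap k E) (z l)) :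
        MvPolynomial (Fin d) E →ₐ[E] MvPolynomial (Fin n) E).toRingHom with hθ
  let β : MvPolynomial (Fin n) k ⧸ p →+* MvPolynomial (Fin n) E ⧸ Q :=
    Ideal.quotientMap Q (MvPolynomial.map (algebraMap k E)) (Ideal.map_le_iff_le_comap.1 hQ)
  have hcomp : β.comp ((Ideal.Quotient.mk p).comp
      (aeval z : MvPolynomial (Fin d) k →ₐ[k] MvPolynomial (Fin n) k).toRingHom) =
      θ.comp (MvPolynomial.map (algebraMap k E)) := by
    apply MvPolynomial.ringHom_ext
    · intro c; simp [β, hθ, algebraMap_eq]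
    · intro i; simp [β, hθ]
  have hX : ∀ f : MvPolynomial (Fin n) k,
      θ.IsIntegralElem (Ideal.Quotient.mk Q (MvPolynomial.map (algebraMap k E) f)) := by
    intro f
    obtain ⟨P, hP, hP0⟩ := h.isIntegral (Ideal.Quotient.mk p f)
    refine ⟨P.map (MvPolynomial.map (algebraMap k E)), hP.map _, ?_⟩
    rw [Polynomial.eval₂_map, ← hcomp]
    have h1 := congrArg β hP0
    rw [Polynomial.hom_eval₂, map_zero] at h1
    exact h1
  intro a
  obtain ⟨a, rfl⟩ := Ideal.Quotient.mk_surjective a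
  induction a using MvPolynomial.induction_on with
  | C c =>
    have h1 : Ideal.Quotient.mk Q (C c) = θ (C c) := by simp [hθ, algebraMap_eq]
    rw [h1]
    exact θ.isIntegralElem_map
  | add a b ha hb => rw [map_add]; exact ha.add _ hb
  | mul_X a i ha =>
    rw [map_mul]
    refine ha.mul _ ?_
    have h1 := hX (X i)
    rwa [map_X] at h1

/-- A prime of `E[x]` over `p` that is transversal to the Noether normalization. -/
lemma of_le (h : IsNoetherLift p z) {Q : Ideal (MvPolynomial (Fin n) E)}
    (hQ : extIdeal E p ≤ Q)
    (hz : ∀ w : MvPolynomial (Fin d) E,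
      aeval (fun l => MvPolynomial.map (algebraMap k E) (z l)) w ∈ Q → w = 0) :
    IsNoetherLift Q fun l => MvPolynomial.map (algebraMap k E) (z l) :=
  ⟨hz, h.isIntegral_of_le hQ⟩

lemma map_aeval (z : Fin d → MvPolynomial (Fin n) k) (f : MvPolynomial (Fin d) k) :
    MvPolynomial.map (algebraMap k E) (aeval z f) =
      aeval (fun l => MvPolynomial.map (algebraMap k E) (z l))
        (MvPolynomial.map (algebraMap k E) f) := by
  have h : (MvPolynomial.map (algebraMap k E)).comp
      (aeval z : MvPolynomial (Fin d) k →ₐ[k] MvPolynomial (Fin n) k).toRingHom =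
      (aeval (fun l => MvPolynomial.map (algebraMap k E) (z l)) :
        MvPolynomial (Fin d) E →ₐ[E] MvPolynomial (Fin n) E).toRingHom.comp
        (MvPolynomial.map (algebraMap k E)) := by
    apply MvPolynomial.ringHom_ext
    · intro c; simp [algebraMap_eq]
    · intro i; simp
  exact RingHom.congr_fun h f

/-- By integrality an element outside `p` has a multiple that is, modulo `p`, a nonzero polynomial
in `z`; so it cannot lie in a `Q` that meets `E[z]` trivially. -/
lemma comap_eq [p.IsPrime] (h : IsNoetherLift p z) {Q : Ideal (MvPolynomial (Fin n) E)}
    (hQ : extIdeal E p ≤ Q)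
    (hz : ∀ w : MvPolynomial (Fin d) E,
      aeval (fun l => MvPolynomial.map (algebraMap k E) (z l)) w ∈ Q → w = 0) :
    Q.comap (MvPolynomial.map (algebraMap k E)) = p := by
  refine le_antisymm (fun a ha => ?_) (Ideal.map_le_iff_le_comap.1 hQ)
  by_contra hap
  obtain ⟨f, hf, b, hb⟩ := exists_ne_zero_dvd_of_isIntegral _ h.isIntegral
    (mt Ideal.Quotient.eq_zero_iff_mem.1 hap)
  obtain ⟨b, rfl⟩ := Ideal.Quotient.mk_surjective b
  rw [← map_mul] at hb
  have h1 : aeval z f - a * b ∈ p := Ideal.Quotient.eq.1 hb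
  have h2 := hQ (Ideal.mem_map_of_mem (MvPolynomial.map (algebraMap k E)) h1)
  rw [map_sub, map_mul, map_aeval] at h2
  have h4 := Q.add_mem h2 (Q.mul_mem_right (MvPolynomial.map (algebraMap k E) b) ha)
  rw [sub_add_cancel] at h4
  have h3 := hz _ h4
  exact hf (map_injective _ (algebraMap k E).injective (by rw [h3, map_zero]))

/-- If `w ≠ 0`, then `E[x] / Q` is integral over `E[z] / (w)`, whose dimension is less than `d`. -/
lemma eq_zero_of_le_ringKrullDim (h : IsNoetherLift p z) {Q : Ideal (MvPolynomial (Fin n) E)}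
    (hQ : extIdeal E p ≤ Q) (hd : (d : WithBot ℕ∞) ≤ ringKrullDim (MvPolynomial (Fin n) E ⧸ Q))
    (w : MvPolynomial (Fin d) E)
    (hw : aeval (fun l => MvPolynomial.map (algebraMap k E) (z l)) w ∈ Q) : w = 0 := by
  by_contra hw0
  have h1 := h.isIntegral_of_le hQ
  set θ := (Ideal.Quotient.mk Q).comp
      (aeval (fun l => MvPolynomial.map (algebraMap k E) (z l)) :
        MvPolynomial (Fin d) E →ₐ[E] MvPolynomial (Fin n) E).toRingHom with hθ
  have hker : ∀ a ∈ Ideal.span {w}, θ a = 0 := by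
    intro a ha
    obtain ⟨b, rfl⟩ := Ideal.mem_span_singleton.1 ha
    rw [map_mul, show θ w = 0 from Ideal.Quotient.eq_zero_iff_mem.2 hw, zero_mul]
  have h2 : (Ideal.Quotient.lift _ θ hker).IsIntegral :=
    RingHom.IsIntegral.tower_top (Ideal.Quotient.mk _) _ (by rwa [Ideal.Quotient.lift_comp_mk])
  have h3 := ringKrullDim_le_of_isIntegral _ h2
  have h4 := ringKrullDim_quotient_succ_le_of_nonZeroDivisor (mem_nonZeroDivisors_of_ne_zero hw0)
  rw [ringKrullDim_mvPolynomial_fin] at h4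
  have h5 : (d : WithBot ℕ∞) + 1 ≤ d := (add_le_add_left (hd.trans h3) 1).trans h4
  have h6 : d + 1 ≤ d := by exact_mod_cast h5
  omega

/-- Elements of a minimal prime are zero divisors modulo `p E[x]`, which contradicts
torsion-freeness over `E[z]`. So all minimal primes of the extension keep the dimension of `p`. -/
lemma eq_zero_of_mem_minimalPrimes [p.IsPrime] (h : IsNoetherLift p z)
    {Q : Ideal (MvPolynomial (Fin n) E)} (hQ : Q ∈ (extIdeal E p).minimalPrimes)
    (w : MvPolynomial (Fin d) E)
    (hw : aeval (fun l => MvPolynomial.map (algebraMap k E) (z l)) w ∈ Q) : w = 0 := by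
  by_contra hw0
  obtain ⟨b, hb, hwb⟩ := Ideal.exists_mul_mem_of_mem_minimalPrimes hQ hw
  exact hb (mem_extIdeal_of_aeval_mul_mem h.eq_zero hw0 hwb)

end IsNoetherLift

end NoetherLift

/-! ### The equidimensional decomposition in terms of primes -/

section Decomposition

variable {E : Type*} [Field E] [IsAlgClosed E] {n : ℕ}

lemma mem_of_forall_mem_zeroLocus {P : Ideal (MvPolynomial (Fin n) E)} [hP : P.IsPrime]
    {f : MvPolynomial (Fin n) E} (hf : ∀ x ∈ zeroLocus E P, aeval x f = 0) : f ∈ P := by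
  have h : f ∈ vanishingIdeal E (zeroLocus E P) := hf
  rwa [vanishingIdeal_zeroLocus_eq_radical, hP.radical] at h

variable {I : Ideal (MvPolynomial (Fin n) E)} (D : EquidimDecomp I)

/-- By the Nullstellensatz the covering of zero sets says `⋂ K j ≤ P`. The `K j` need not be
radical, which a prime does not notice. -/
lemma EquidimDecomp.exists_K_le {P : Ideal (MvPolynomial (Fin n) E)} [hP : P.IsPrime]
    (h : I ≤ P) : ∃ j, D.K j ≤ P := by
  obtain ⟨j, -, hj⟩ := (Ideal.IsPrime.inf_le' hP (s := Finset.univ) (f := D.K)).1 fun f hf => by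
    refine mem_of_forall_mem_zeroLocus fun x hx => ?_
    have hxI : x ∈ zeroLocus E I := zeroLocus_anti_mono h hx
    rw [D.zeroLocus_eq, Set.mem_iUnion] at hxI
    obtain ⟨j, hj⟩ := hxI
    exact hj f ((Submodule.mem_finsetInf.1 hf) j (Finset.mem_univ j))
  exact ⟨j, hj⟩

lemma EquidimDecomp.exists_minimalPrimes_le {P : Ideal (MvPolynomial (Fin n) E)}
    [hP : P.IsPrime] {j : Fin D.m} (h : D.K j ≤ P) :
    ∃ Q ∈ I.minimalPrimes, ringKrullDim (MvPolynomial (Fin n) E ⧸ Q) = (D.dim j : WithBot ℕ∞) ∧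
      Q ≤ P := by
  classical
  have hfin := I.finite_minimalPrimes_of_isNoetherianRing (MvPolynomial (Fin n) E)
  obtain ⟨Q, hQ, hQP⟩ := (Ideal.IsPrime.inf_le' hP (s := hfin.toFinset.filter fun Q =>
      ringKrullDim (MvPolynomial (Fin n) E ⧸ Q) = (D.dim j : WithBot ℕ∞)) (f := id)).1
    fun f hf => by
      refine mem_of_forall_mem_zeroLocus fun x hx => ?_
      have hxK : x ∈ zeroLocus E (D.K j) := zeroLocus_anti_mono h hx
      rw [D.zeroLocus_K] at hxK
      obtain ⟨Q, hQ, hd, hxQ⟩ := hxK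
      exact hxQ f ((Submodule.mem_finsetInf.1 hf) Q (by simp [hQ, hd]))
  simp only [Finset.mem_filter, Set.Finite.mem_toFinset] at hQ
  exact ⟨Q, hQ.1, hQ.2, hQP⟩

end Decomposition

/-! ### Dimension of primary components and of the isolated part -/

section Dimension

variable {R : Type*} [CommRing R]

lemma ringKrullDim_quotient_anti {I J : Ideal R} (h : I ≤ J) :
    ringKrullDim (R ⧸ J) ≤ ringKrullDim (R ⧸ I) :=
  ringKrullDim_le_of_surjective _ (Ideal.Quotient.factor_surjective h)

lemma ringKrullDim_quotient_radical (I : Ideal R) :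
    ringKrullDim (R ⧸ I.radical) = ringKrullDim (R ⧸ I) := by
  rw [ringKrullDim_quotient, ringKrullDim_quotient, PrimeSpectrum.zeroLocus_radical]

lemma ringKrullDim_quotient_add_one_le_of_lt {p P : Ideal R} [p.IsPrime] (h : p < P) :
    ringKrullDim (R ⧸ P) + 1 ≤ ringKrullDim (R ⧸ p) := by
  obtain ⟨a, haP, hap⟩ := SetLike.exists_of_lt h
  have ha : Ideal.Quotient.mk p a ≠ 0 := mt Ideal.Quotient.eq_zero_iff_mem.1 hap
  refine le_trans ?_ (ringKrullDim_quotient_succ_le_of_nonZeroDivisor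
    (mem_nonZeroDivisors_of_ne_zero ha))
  have hker : ∀ b ∈ Ideal.span {Ideal.Quotient.mk p a}, Ideal.Quotient.factor h.le b = 0 := by
    intro b hb
    obtain ⟨c, rfl⟩ := Ideal.mem_span_singleton.1 hb
    rw [map_mul, Ideal.Quotient.factor_mk, Ideal.Quotient.eq_zero_iff_mem.2 haP, zero_mul]
  exact add_le_add_left (ringKrullDim_le_of_surjective _
    (Ideal.Quotient.lift_surjective_of_surjective _ hker
      (Ideal.Quotient.factor_surjective h.le))) 1

/-- In dimension μ the radical is not minimal, so a minimal prime strictly below it has larger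
dimension; above μ the radical itself serves. These are the components removed by inverting the `h
j`. -/
lemma exists_isPrime_of_not_isolated {I q : Ideal R} (hq : q.IsPrimary) (hI : I ≤ q) {μ : ℕ}
    (hμ : (μ : WithBot ℕ∞) ≤ ringKrullDim (R ⧸ q))
    (hna : ¬ (q.radical ∈ I.minimalPrimes ∧ ringKrullDim (R ⧸ q) = (μ : WithBot ℕ∞))) :
    ∃ p : Ideal R, p.IsPrime ∧ I ≤ p ∧ p ≤ q.radical ∧ (μ : WithBot ℕ∞) < ringKrullDim (R ⧸ p) := by
  have hprime : q.radical.IsPrime := Ideal.isPrime_radical hq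
  rcases hμ.eq_or_lt with h | h
  · obtain ⟨p, hp, hpq⟩ := Ideal.exists_minimalPrimes_le (hI.trans q.le_radical)
    have hne : p ≠ q.radical := by
      rintro rfl
      exact hna ⟨hp, h.symm⟩
    have := hp.1.1
    have h1 := ringKrullDim_quotient_add_one_le_of_lt (lt_of_le_of_ne hpq hne)
    rw [ringKrullDim_quotient_radical, ← h] at h1
    refine ⟨p, hp.1.1, hp.1.2, hpq, lt_of_lt_of_le ?_ h1⟩
    exact_mod_cast Nat.lt_succ_self μ
  · exact ⟨q.radical, hprime, hI.trans q.le_radical, le_rfl, by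
      rwa [ringKrullDim_quotient_radical]⟩

lemma exists_le_of_isolatedPart_le {I : Ideal R} {t : Finset (Ideal R)} {μ : ℕ} {P : Ideal R}
    [hP : P.IsPrime] (h : isolatedPart I t μ ≤ P) : ∃ q, (q ∈ t ∧ q.radical ∈ I.minimalPrimes ∧
      ringKrullDim (R ⧸ q) = (μ : WithBot ℕ∞)) ∧ q ≤ P := by
  classical
  obtain ⟨q, hq, h⟩ := (Ideal.IsPrime.inf_le' hP (s := t.filter fun q =>
    q.radical ∈ I.minimalPrimes ∧ ringKrullDim (R ⧸ q) = (μ : WithBot ℕ∞)) (f := id)).1 (by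
      rw [Finset.inf_id_eq_sInf, Finset.coe_filter]
      exact h)
  exact ⟨q, Finset.mem_filter.1 hq, h⟩

lemma ringKrullDim_quotient_le_of_forall {J : Ideal R} {D : WithBot ℕ∞}
    (h : ∀ P : Ideal R, P.IsPrime → J ≤ P → ∃ q ≤ P, ringKrullDim (R ⧸ q) ≤ D) :
    ringKrullDim (R ⧸ J) ≤ D := by
  rw [ringKrullDim_quotient]
  refine iSup_le fun l => ?_
  obtain ⟨q, hq, hd⟩ := h l.head.1.asIdeal l.head.1.isPrime l.head.2
  rw [ringKrullDim_quotient] at hd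
  let l' : LTSeries (PrimeSpectrum.zeroLocus (R := R) q) :=
    { length := l.length
      toFun := fun i => ⟨(l i).1, hq.trans (LTSeries.head_le l i)⟩
      step := fun i => l.step i }
  exact (Order.LTSeries.length_le_krullDim l').trans hd

lemma ringKrullDim_quotient_isolatedPart_le (I : Ideal R) (t : Finset (Ideal R)) (μ : ℕ) :
    ringKrullDim (R ⧸ isolatedPart I t μ) ≤ (μ : WithBot ℕ∞) :=
  ringKrullDim_quotient_le_of_forall fun _ _ hJ =>
    let ⟨q, hq, hqP⟩ := exists_le_of_isolatedPart_le hJ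
    ⟨q, hqP, hq.2.2.le⟩

lemma isolatedPart_eq_top_or_ringKrullDim_eq (I : Ideal R) (t : Finset (Ideal R)) (μ : ℕ) :
    isolatedPart I t μ = ⊤ ∨ ringKrullDim (R ⧸ isolatedPart I t μ) = (μ : WithBot ℕ∞) := by
  by_cases hq : ∃ q, q ∈ t ∧ q.radical ∈ I.minimalPrimes ∧
      ringKrullDim (R ⧸ q) = (μ : WithBot ℕ∞)
  · obtain ⟨q, hq⟩ := hq
    refine Or.inr (le_antisymm (ringKrullDim_quotient_isolatedPart_le I t μ) ?_)
    rw [← hq.2.2]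
    exact ringKrullDim_quotient_anti (sInf_le hq)
  · push Not at hq
    refine Or.inl (sInf_eq_top.2 fun q hq' => ?_)
    exact absurd hq'.2.2 (hq q hq'.1 hq'.2.1)

end Dimension

/-! ### Which components survive in the generic section -/

section Components

variable {k E K : Type*} [Field k] [Field E] [Field K] [Algebra k E] [Algebra E K] [Algebra k K]
  [IsScalarTower k E K] {n : ℕ}

lemma map_map_algebraMap {σ : Type*} (f : MvPolynomial σ k) :
    MvPolynomial.map (algebraMap E K) (MvPolynomial.map (algebraMap k E) f) =
      MvPolynomial.map (algebraMap k K) f := by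
  rw [map_map, ← IsScalarTower.algebraMap_eq]

/-- A generic linear combination of elements `g s` of `E[x]` lies in a prime `P` of `K[x]`
transversal to a Noether normalization of `p ⊆ P` only if all `g s` lie in `p`. -/
lemma mem_of_sum_mem {d r : ℕ} {p : Ideal (MvPolynomial (Fin n) E)} [p.IsPrime]
    {z : Fin d → MvPolynomial (Fin n) E} (h : IsNoetherLift p z)
    {P : Ideal (MvPolynomial (Fin n) K)} (hP : extIdeal K p ≤ P)
    (hz : ∀ w : MvPolynomial (Fin d) K,
      aeval (fun l => MvPolynomial.map (algebraMap E K) (z l)) w ∈ P → w = 0)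
    {g : Fin r → MvPolynomial (Fin n) E} {c : Fin r → K} (hc : AlgebraicIndependent E c)
    (hg : ∑ s, C (c s) * MvPolynomial.map (algebraMap E K) (g s) ∈ P) (s : Fin r) : g s ∈ p := by
  classical
  by_contra hs
  let φ := (Ideal.Quotient.mk p).comp
    (aeval z : MvPolynomial (Fin d) E →ₐ[E] MvPolynomial (Fin n) E).toRingHom
  -- The combination with indeterminate coefficients over `E[x] / p`. If nonzero, it divides a
  -- nonzero polynomial `w` in `z` and these indeterminates, by integrality. Substituting the
  -- independent `c s` keeps `w` nonzero but puts it into `P`, contrary to `hz`.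
  let G : MvPolynomial (Fin r) (MvPolynomial (Fin n) E ⧸ p) :=
    ∑ s, C (Ideal.Quotient.mk p (g s)) * X s
  have hG : G ≠ 0 := by
    intro h0
    have h1 := congrArg (coeff (Finsupp.single s 1)) h0
    simp only [G, coeff_sum, coeff_C_mul, coeff_zero, coeff_X, Finsupp.single_left_inj one_ne_zero,
      mul_ite, mul_one, mul_zero, Finset.sum_ite_eq', Finset.mem_univ, if_true] at h1
    exact hs (Ideal.Quotient.eq_zero_iff_mem.1 h1)
  have hint : RingHom.IsIntegral (R := MvPolynomial (Fin r) (MvPolynomial (Fin d) E))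
      (A := MvPolynomial (Fin r) (MvPolynomial (Fin n) E ⧸ p)) (MvPolynomial.map φ) := by
    let _ : Algebra (MvPolynomial (Fin d) E) (MvPolynomial (Fin n) E ⧸ p) := φ.toAlgebra
    have : Algebra.IsIntegral (MvPolynomial (Fin d) E) (MvPolynomial (Fin n) E ⧸ p) :=
      ⟨h.isIntegral⟩
    let _ := algebraMvPolynomial (R := MvPolynomial (Fin d) E)
      (S := MvPolynomial (Fin n) E ⧸ p) (σ := Fin r)
    have h2 : Algebra.IsIntegral (MvPolynomial (Fin r) (MvPolynomial (Fin d) E))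
      (MvPolynomial (Fin r) (MvPolynomial (Fin n) E ⧸ p)) := inferInstance
    exact h2.1
  obtain ⟨w, hw, b, hb⟩ := exists_ne_zero_dvd_of_isIntegral
    (R := MvPolynomial (Fin r) (MvPolynomial (Fin d) E))
    (S := MvPolynomial (Fin r) (MvPolynomial (Fin n) E ⧸ p)) _ hint (a := G) hG
  let β : MvPolynomial (Fin n) E ⧸ p →+* MvPolynomial (Fin n) K ⧸ P :=
    Ideal.quotientMap P (MvPolynomial.map (algebraMap E K)) (Ideal.map_le_iff_le_comap.1 hP)
  let Θ : MvPolynomial (Fin r) (MvPolynomial (Fin n) E ⧸ p) →+* MvPolynomial (Fin n) K ⧸ P :=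
    eval₂Hom β (fun s => Ideal.Quotient.mk P (C (c s)))
  have hΘG : Θ G = 0 := by
    rw [← Ideal.Quotient.eq_zero_iff_mem] at hg
    rw [← hg, map_sum, map_sum]
    refine Finset.sum_congr rfl fun s _ => ?_
    rw [map_mul, map_mul, mul_comm]
    simp [Θ, β]
  let ψ : MvPolynomial (Fin r) (MvPolynomial (Fin d) E) →+* MvPolynomial (Fin d) K :=
    (MvPolynomial.map (aeval c : MvPolynomial (Fin r) E →ₐ[E] K).toRingHom).comp
      (commAlgEquiv E (Fin r) (Fin d)).toRingEquiv.toRingHom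
  have hψ : Function.Injective ψ :=
    (map_injective _ hc).comp (commAlgEquiv E (Fin r) (Fin d)).injective
  have hcomp : Θ.comp (MvPolynomial.map φ) = ((Ideal.Quotient.mk P).comp
      (aeval (fun l => MvPolynomial.map (algebraMap E K) (z l)) :
        MvPolynomial (Fin d) K →ₐ[K] MvPolynomial (Fin n) K).toRingHom).comp ψ := by
    apply MvPolynomial.ringHom_ext
    · intro f
      have h1 : ψ (C f) = MvPolynomial.map (algebraMap E K) f := by
        change MvPolynomial.map _ (commAlgEquiv E (Fin r) (Fin d) (C f)) = _
        have h0 : (aeval c : MvPolynomial (Fin r) E →ₐ[E] K).toRingHom.comp C =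
            algebraMap E K := RingHom.ext fun a => aeval_C c a
        rw [commAlgEquiv_C, map_map, h0]
      rw [RingHom.comp_apply, RingHom.comp_apply, h1, map_C, RingHom.comp_apply]
      simp only [Θ, coe_eval₂Hom, eval₂_C]
      exact congrArg (Ideal.Quotient.mk P) (IsNoetherLift.map_aeval (E := K) z f)
    · intro s
      have h1 : ψ (X s) = C (c s) := by
        change MvPolynomial.map _ (commAlgEquiv E (Fin r) (Fin d) (X s)) = _
        rw [commAlgEquiv_X, map_C]
        simp
      rw [RingHom.comp_apply, RingHom.comp_apply, h1, map_X]
      simp [Θ, algebraMap_eq]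
  have h3 := RingHom.congr_fun hcomp w
  rw [RingHom.comp_apply, hb, map_mul, hΘG, zero_mul] at h3
  have h4 := hz _ (Ideal.Quotient.eq_zero_iff_mem.1 h3.symm)
  exact hw (hψ (by rw [h4, map_zero]))

variable [IsAlgClosed E] {I : Ideal (MvPolynomial (Fin n) k)} (D : EquidimDecomp (extIdeal E I))
  {μ : ℕ}

/-- A minimal prime `Q ≤ P` of the extension of `p` has the same dimension as `p` and contains some
`K j`. As `Q` contains a component of dimension `dim j`, this is at least `dim p > μ`. -/
lemma EquidimDecomp.exists_above_K_le {p : Ideal (MvPolynomial (Fin n) k)} [p.IsPrime]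
    (hI : I ≤ p) (hd : (μ : WithBot ℕ∞) < ringKrullDim (MvPolynomial (Fin n) k ⧸ p))
    {P : Ideal (MvPolynomial (Fin n) E)} [P.IsPrime] (hP : extIdeal E p ≤ P) :
    ∃ j : D.Above μ, D.K j ≤ P := by
  obtain ⟨d, hpd⟩ := exists_ringKrullDim_eq (Ideal.IsPrime.ne_top (I := p) inferInstance)
  obtain ⟨z, hz⟩ := exists_isNoetherLift hpd
  obtain ⟨Q, hQ, hQP⟩ := Ideal.exists_minimalPrimes_le hP
  have := hQ.1.1
  have hQd := (hz.of_le hQ.1.2 (hz.eq_zero_of_mem_minimalPrimes hQ)).ringKrullDim_eq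
  obtain ⟨j, hj⟩ := D.exists_K_le ((Ideal.map_mono hI).trans hQ.1.2)
  obtain ⟨Q', -, hQ'd, hQ'⟩ := D.exists_minimalPrimes_le hj
  have h1 := ringKrullDim_quotient_anti hQ'
  rw [hQd, hQ'd] at h1
  rw [hpd] at hd
  have h2 : d ≤ D.dim j := by exact_mod_cast h1
  have h3 : μ < d := by exact_mod_cast hd
  exact ⟨⟨j, h3.trans_le h2⟩, hj.trans hQP⟩

variable {t : Finset (Ideal (MvPolynomial (Fin n) k))}

lemma IsPrimaryDecomp.le {R : Type*} [CommRing R] {I : Ideal R} {t : Finset (Ideal R)}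
    (ht : IsPrimaryDecomp I t) {q : Ideal R} (hq : q ∈ t) : I ≤ q :=
  ht.inf_eq ▸ Finset.inf_le (f := id) hq

/-- An isolated component of dimension μ needs no factor, and one of smaller dimension is killed by
a relation between the μ elements `y`. For any other, all primes over it contain a `K j` with `dim j
> μ`, so `H` is nilpotent modulo it. -/
lemma exists_aeval_mul_mem_of_mem (ht : IsPrimaryDecomp I t) (y : Fin μ → MvPolynomial (Fin n) K)
    {H : MvPolynomial (Fin n) K} (hH : ∀ P : Ideal (MvPolynomial (Fin n) K), P.IsPrime →
      ∀ j : D.Above μ, extIdeal K (D.K j) ≤ P → H ∈ P)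
    {q : Ideal (MvPolynomial (Fin n) k)} (hq : q ∈ t) :
    ∃ f : MvPolynomial (Fin μ) K, f ≠ 0 ∧ ∃ e : ℕ, ∀ b ∈ extIdeal K (isolatedPart I t μ),
      aeval y f * H ^ e * b ∈ extIdeal K q := by
  by_cases ha : q.radical ∈ I.minimalPrimes ∧
      ringKrullDim (MvPolynomial (Fin n) k ⧸ q) = (μ : WithBot ℕ∞)
  · exact ⟨1, one_ne_zero, 0, fun b hb => Ideal.mul_mem_left _ _
      (mem_extIdeal_sInf_iff.1 hb q ⟨hq, ha⟩)⟩
  rcases lt_or_ge (ringKrullDim (MvPolynomial (Fin n) k ⧸ q)) (μ : WithBot ℕ∞) with hlt | hge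
  · obtain ⟨f, hf, hmem⟩ := exists_ne_zero_aeval_mem_extIdeal hlt y
    exact ⟨f, hf, 0, fun b _ => Ideal.mul_mem_right _ _ (Ideal.mul_mem_right _ _ hmem)⟩
  · obtain ⟨p, hp, hIp, hpq, hd⟩ := exists_isPrime_of_not_isolated (ht.primary q hq) (ht.le hq)
      hge ha
    have hrad : H ∈ (extIdeal K q).radical := by
      rw [Ideal.radical_eq_sInf, Submodule.mem_sInf]
      rintro P ⟨hqP, hP⟩
      change Ideal (MvPolynomial (Fin n) K) at P
      have : (P.comap (MvPolynomial.map (algebraMap E K))).IsPrime := Ideal.comap_isPrime _ _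
      have h1 : extIdeal E p ≤ P.comap (MvPolynomial.map (algebraMap E K)) := by
        rw [extIdeal, Ideal.map_le_iff_le_comap, Ideal.comap_comap]
        intro f hf
        rw [Ideal.mem_comap, RingHom.comp_apply, map_map_algebraMap]
        have h2 : (P.comap (MvPolynomial.map (algebraMap k K))).IsPrime := Ideal.comap_isPrime _ _
        exact h2.radical_le_iff.2 (Ideal.map_le_iff_le_comap.1 hqP) (hpq hf)
      obtain ⟨j, hj⟩ := D.exists_above_K_le hIp hd h1
      exact hH P hP j (Ideal.map_le_iff_le_comap.2 hj)
    obtain ⟨e, he⟩ := hrad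
    exact ⟨1, one_ne_zero, e, fun b _ => Ideal.mul_mem_right _ _ (Ideal.mul_mem_left _ _ he)⟩

/-- Away from the pieces of dimension larger than `μ` and from a hypersurface pulled back from
`μ`-space, the scheme defined by `I` is its isolated part of dimension `μ`. -/
theorem exists_aeval_mul_mem (ht : IsPrimaryDecomp I t) (y : Fin μ → MvPolynomial (Fin n) K)
    {H : MvPolynomial (Fin n) K} (hH : ∀ P : Ideal (MvPolynomial (Fin n) K), P.IsPrime →
      ∀ j : D.Above μ, extIdeal K (D.K j) ≤ P → H ∈ P) :
    ∃ f : MvPolynomial (Fin μ) K, f ≠ 0 ∧ ∃ e : ℕ, ∀ b ∈ extIdeal K (isolatedPart I t μ),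
      aeval y f * H ^ e * b ∈ extIdeal K I := by
  choose f hf e he using fun q : t => exists_aeval_mul_mem_of_mem D ht y hH q.2
  refine ⟨∏ q, f q, Finset.prod_ne_zero_iff.2 fun q _ => hf q, ∑ q, e q, fun b hb => ?_⟩
  have hI : I = sInf (t : Set (Ideal (MvPolynomial (Fin n) k))) := by
    rw [← ht.inf_eq, Finset.inf_id_eq_sInf]
  rw [hI, mem_extIdeal_sInf_iff]
  intro q hq
  have h1 : f ⟨q, hq⟩ ∣ ∏ q, f q := Finset.dvd_prod_of_mem _ (Finset.mem_univ _)
  have h2 : e ⟨q, hq⟩ ≤ ∑ q, e q :=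
    Finset.single_le_sum (f := e) (fun _ _ => Nat.zero_le _) (Finset.mem_univ _)
  exact Ideal.mem_of_dvd _ (mul_dvd_mul_right (mul_dvd_mul (map_dvd (aeval y) h1)
    (pow_dvd_pow H h2)) b) (he ⟨q, hq⟩ b hb)

/-- A generic element of `K j` vanishes on the isolated part of dimension `μ < dim j` only over a
hypersurface of `μ`-space. -/
theorem exists_aeval_mem_sup_span (y : Fin μ → MvPolynomial (Fin n) K) (j : D.Above μ) {r : ℕ}
    {g : Fin r → MvPolynomial (Fin n) E} (hg : Ideal.span (Set.range g) = D.K j)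
    {c : Fin r → K} (hc : AlgebraicIndependent E c) :
    ∃ f : MvPolynomial (Fin μ) K, f ≠ 0 ∧ aeval y f ∈ extIdeal K (isolatedPart I t μ) ⊔
      Ideal.span {∑ s, C (c s) * MvPolynomial.map (algebraMap E K) (g s)} := by
  by_contra! hcon
  -- Otherwise some prime `P` over the sum contains no nonzero polynomial in `y`, so its dimension
  -- is at least μ and it is transversal to a Noether normalization of the component `q` below it.
  obtain ⟨P, hP, haP, hdisj⟩ := Ideal.exists_le_prime_disjoint (extIdeal K (isolatedPart I t μ) ⊔
      Ideal.span {∑ s, C (c s) * MvPolynomial.map (algebraMap E K) (g s)})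
    ((nonZeroDivisors (MvPolynomial (Fin μ) K)).map (aeval y)) (by
      rw [Set.disjoint_left]
      rintro _ ha ⟨f, hf, rfl⟩
      exact hcon f (nonZeroDivisors.ne_zero hf) ha)
  rw [sup_le_iff, Ideal.span_singleton_le_iff_mem] at haP
  have hdP := le_ringKrullDim_of_algebraicIndependent (algebraicIndependent_mk (J := P) (z := y)
    fun f hf => by
      by_contra hf0
      exact Set.disjoint_left.1 hdisj hf ⟨f, mem_nonZeroDivisors_of_ne_zero hf0, rfl⟩)
  have hPk : (P.comap (MvPolynomial.map (algebraMap k K))).IsPrime := Ideal.comap_isPrime _ _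
  obtain ⟨q, hq, hqP⟩ := exists_le_of_isolatedPart_le (Ideal.map_le_iff_le_comap.1 haP.1)
  have hp := hq.2.1.1.1
  have hpP : extIdeal K q.radical ≤ P :=
    Ideal.map_le_iff_le_comap.2 (hPk.radical_le_iff.2 hqP)
  obtain ⟨z, hz⟩ := exists_isNoetherLift (p := q.radical) (d := μ) (by
    rw [ringKrullDim_quotient_radical]; exact hq.2.2)
  have hzP := hz.eq_zero_of_le_ringKrullDim hpP hdP
  set P₀ := P.comap (MvPolynomial.map (algebraMap E K)) with hP₀
  have : P₀.IsPrime := Ideal.comap_isPrime _ _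
  have hpP₀ : extIdeal E q.radical ≤ P₀ := by
    rw [extIdeal, Ideal.map_le_iff_le_comap]
    intro f hf
    rw [Ideal.mem_comap, hP₀, Ideal.mem_comap, map_map_algebraMap]
    exact hpP (Ideal.mem_map_of_mem _ hf)
  have hzP₀ : ∀ w : MvPolynomial (Fin μ) E,
      aeval (fun l => MvPolynomial.map (algebraMap k E) (z l)) w ∈ P₀ → w = 0 := by
    intro w hw
    rw [hP₀, Ideal.mem_comap, IsNoetherLift.map_aeval] at hw
    simp only [map_map_algebraMap] at hw
    exact map_injective _ (algebraMap E K).injective (by rw [hzP _ hw, map_zero])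
  have hz₀ := hz.of_le hpP₀ hzP₀
  have hgP₀ := mem_of_sum_mem (K := K) hz₀ (P := P) (Ideal.map_le_iff_le_comap.2 le_rfl)
    (fun w hw => hzP w (by simpa only [map_map_algebraMap] using hw)) hc haP.2
  have hKP₀ : D.K j ≤ P₀ := by
    rw [← hg, Ideal.span_le]
    rintro _ ⟨s, rfl⟩
    exact hgP₀ s
  -- This component `Q` has dimension `dim j > μ`. Its contraction lies between `I` and `q.radical`,
  -- so it equals the latter by minimality; but then `E[x] / Q` is integral over a polynomial ring
  -- in μ variables.
  obtain ⟨Q, hQ, hQd, hQP⟩ := D.exists_minimalPrimes_le hKP₀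
  have hQk : (Q.comap (MvPolynomial.map (algebraMap k E))).IsPrime := by
    have := hQ.1.1
    exact Ideal.comap_isPrime _ _
  have hQp : q.radical ≤ Q.comap (MvPolynomial.map (algebraMap k E)) := by
    refine hq.2.1.2 ⟨hQk, Ideal.map_le_iff_le_comap.1 hQ.1.2⟩ ?_
    rw [← hz.comap_eq hpP₀ hzP₀]
    exact Ideal.comap_mono hQP
  have hle := ringKrullDim_le_of_isIntegral _
    (hz.isIntegral_of_le (Ideal.map_le_iff_le_comap.2 hQp : extIdeal E q.radical ≤ Q))
  rw [hQd, ringKrullDim_mvPolynomial_fin] at hle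
  have h1 : D.dim j ≤ μ := by exact_mod_cast hle
  exact absurd j.2 (not_lt.2 h1)

end Components

/-! ### The section algebra as a generic fibre -/

section Section

open TensorProduct

variable {σ ι κ : Type*}

/-- The ideal of the section by the hypersurfaces `L l` of the part of the scheme defined by `I`
where all `h j` are invertible, with the inverses of the `h j` as extra variables. -/
def sectionIdealOf {S : Type*} [CommRing S] (I : Ideal (MvPolynomial σ S))
    (L : κ → MvPolynomial σ S) (h : ι → MvPolynomial σ S) : Ideal (MvPolynomial (σ ⊕ ι) S) :=
  I.map (rename (Sum.inl : σ → σ ⊕ ι)) ⊔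
  Ideal.span (Set.range fun l => rename (Sum.inl : σ → σ ⊕ ι) (L l)) ⊔
  Ideal.span (Set.range fun j : ι => 1 - X (Sum.inr j) * rename (Sum.inl : σ → σ ⊕ ι) (h j))

lemma sectionIdealOf_le_iff {S : Type*} [CommRing S] {I : Ideal (MvPolynomial σ S)}
    {L : κ → MvPolynomial σ S} {h : ι → MvPolynomial σ S} {Q : Ideal (MvPolynomial (σ ⊕ ι) S)} :
    sectionIdealOf I L h ≤ Q ↔ (∀ f ∈ I, rename (Sum.inl : σ → σ ⊕ ι) f ∈ Q) ∧
      (∀ l, rename (Sum.inl : σ → σ ⊕ ι) (L l) ∈ Q) ∧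
      ∀ j, 1 - X (Sum.inr j) * rename (Sum.inl : σ → σ ⊕ ι) (h j) ∈ Q := by
  rw [sectionIdealOf, sup_le_iff, sup_le_iff, Ideal.map_le_iff_le_comap, Ideal.span_le,
    Ideal.span_le, Set.range_subset_iff, Set.range_subset_iff, and_assoc]
  rfl

lemma map_sectionIdealOf {S S' : Type*} [CommRing S] [CommRing S'] (φ : S →+* S')
    (I : Ideal (MvPolynomial σ S)) (L : κ → MvPolynomial σ S) (h : ι → MvPolynomial σ S) :
    (sectionIdealOf I L h).map (MvPolynomial.map φ) =
      sectionIdealOf (I.map (MvPolynomial.map φ)) (fun l => MvPolynomial.map φ (L l))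
        (fun j => MvPolynomial.map φ (h j)) := by
  obtain ⟨h1, h2, h3⟩ := sectionIdealOf_le_iff.1 (le_refl (sectionIdealOf I L h))
  obtain ⟨h1', h2', h3'⟩ := sectionIdealOf_le_iff.1 (le_refl (sectionIdealOf
    (I.map (MvPolynomial.map φ)) (fun l => MvPolynomial.map φ (L l))
    (fun j => MvPolynomial.map φ (h j))))
  apply le_antisymm
  · rw [Ideal.map_le_iff_le_comap, sectionIdealOf_le_iff]
    refine ⟨fun f hf => ?_, fun l => ?_, fun j => ?_⟩
    · rw [Ideal.mem_comap, map_rename]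
      exact h1' _ (Ideal.mem_map_of_mem _ hf)
    · rw [Ideal.mem_comap, map_rename]
      exact h2' l
    · rw [Ideal.mem_comap, map_sub, map_one, map_mul, map_X, map_rename]
      exact h3' j
  · rw [sectionIdealOf_le_iff]
    refine ⟨fun f hf => ?_, fun l => ?_, fun j => ?_⟩
    · have h4 : I.map (MvPolynomial.map φ) ≤ ((sectionIdealOf I L h).map
          (MvPolynomial.map φ)).comap (rename (Sum.inl : σ → σ ⊕ ι)) := by
        rw [Ideal.map_le_iff_le_comap]
        intro f hf
        rw [Ideal.mem_comap, Ideal.mem_comap, ← map_rename]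
        exact Ideal.mem_map_of_mem _ (h1 f hf)
      exact h4 hf
    · rw [← map_rename]
      exact Ideal.mem_map_of_mem _ (h2 l)
    · have h4 := Ideal.mem_map_of_mem (MvPolynomial.map φ) (h3 j)
      rwa [map_sub, map_one, map_mul, map_X, map_rename] at h4

/-- A section by hypersurfaces `y l = z l` with independent transcendental `z l` is the generic
fibre of the map given by the `y l`; only the part `J` of `I` that is not contracted survives. -/
theorem nonempty_algEquiv_sectionIdealOf {K F A : Type*} {d : ℕ} [Field K] [Field F] [Algebra K F]
    [Algebra (MvPolynomial (Fin d) K) F] [FaithfulSMul (MvPolynomial (Fin d) K) F]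
    [IsScalarTower K (MvPolynomial (Fin d) K) F] [CommRing A] [Algebra K A]
    [Algebra (MvPolynomial (Fin d) K) A] [IsScalarTower K (MvPolynomial (Fin d) K) A]
    [Fintype ι] {I J : Ideal (MvPolynomial σ K)} (hIJ : I ≤ J) {y : Fin d → MvPolynomial σ K}
    {h : ι → MvPolynomial σ K} (π : MvPolynomial σ K →ₐ[K] A) (hπ : Function.Surjective π)
    (hker : ∀ b, π b = 0 ↔ b ∈ J)
    (hy : ∀ l, algebraMap (MvPolynomial (Fin d) K) A (X l) = π (y l))
    (hJ : ∃ f : MvPolynomial (Fin d) K, f ≠ 0 ∧ ∃ e : ℕ, ∀ b ∈ J,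
      aeval y f * (∏ j, h j) ^ e * b ∈ I)
    (hh : ∀ j, ∃ f : MvPolynomial (Fin d) K, f ≠ 0 ∧ aeval y f ∈ J ⊔ Ideal.span {h j}) :
    Nonempty ((MvPolynomial (σ ⊕ ι) F ⧸ sectionIdealOf (I.map (MvPolynomial.map (algebraMap K F)))
      (fun l : Fin d => C (algebraMap (MvPolynomial (Fin d) K) F (X l)) -
        MvPolynomial.map (algebraMap K F) (y l))
      (fun j => MvPolynomial.map (algebraMap K F) (h j))) ≃ₐ[F]
        F ⊗[MvPolynomial (Fin d) K] A) := by
  set R := MvPolynomial (Fin d) K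
  set 𝔍 := sectionIdealOf (I.map (MvPolynomial.map (algebraMap K F)))
      (fun l : Fin d => C (algebraMap R F (X l)) - MvPolynomial.map (algebraMap K F) (y l))
      (fun j => MvPolynomial.map (algebraMap K F) (h j)) with h𝔍
  obtain ⟨hI𝔍, hL𝔍, hh𝔍⟩ := sectionIdealOf_le_iff.1 h𝔍.symm.le
  have halg : ∀ f : R, algebraMap R A f = π (aeval y f) := by
    intro f
    have h1 : IsScalarTower.toAlgHom K R A = π.comp (aeval y) := by
      apply MvPolynomial.algHom_ext
      intro l
      rw [AlgHom.comp_apply, aeval_X, ← hy]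
      rfl
    exact AlgHom.congr_fun h1 f
  have hF : ∀ f : R, f ≠ 0 → IsUnit (algebraMap R F f) := fun f hf =>
    IsUnit.mk0 _ (by rwa [Ne, FaithfulSMul.algebraMap_eq_zero_iff])
  have htmul : ∀ f : R, algebraMap R F f ⊗ₜ[R] (1 : A) = 1 ⊗ₜ[R] algebraMap R A f := fun f => by
    rw [Algebra.algebraMap_eq_smul_one, Algebra.algebraMap_eq_smul_one, smul_tmul]
  -- the `h j` are invertible in the generic fibre
  have hunit : ∀ j, ∃ s : F ⊗[R] A, (1 ⊗ₜ[R] π (h j)) * s = 1 := by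
    intro j
    obtain ⟨f, hf, hmem⟩ := hh j
    obtain ⟨a, ha, b, hb, hab⟩ := Submodule.mem_sup.1 hmem
    obtain ⟨c, rfl⟩ := Ideal.mem_span_singleton.1 hb
    have h1 : π (h j) * π c = algebraMap R A f := by
      rw [halg, ← hab, map_add, (hker a).2 ha, zero_add, map_mul]
    refine ⟨(algebraMap R F f)⁻¹ ⊗ₜ π c, ?_⟩
    rw [Algebra.TensorProduct.tmul_mul_tmul, one_mul, h1, Algebra.algebraMap_eq_smul_one (A := A),
      ← smul_tmul, Algebra.smul_def, mul_inv_cancel₀ (hF f hf).ne_zero]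
    rfl
  choose s hs using hunit
  let Ψ₀ : MvPolynomial (σ ⊕ ι) F →ₐ[F] F ⊗[R] A :=
    aeval (Sum.elim (fun i => 1 ⊗ₜ[R] π (X i)) s)
  have hΨ₀ : ∀ f : MvPolynomial σ K,
      Ψ₀ (rename Sum.inl (MvPolynomial.map (algebraMap K F) f)) = 1 ⊗ₜ[R] π f := by
    intro f
    have h1 : (Ψ₀.toRingHom.comp (rename (Sum.inl : σ → σ ⊕ ι)).toRingHom).comp
        (MvPolynomial.map (algebraMap K F)) =
        (Algebra.TensorProduct.includeRight : A →ₐ[R] F ⊗[R] A).toRingHom.comp π.toRingHom := by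
      apply MvPolynomial.ringHom_ext
      · intro c
        have h2 : algebraMap K F c = algebraMap R F (C c) := IsScalarTower.algebraMap_apply K R F c
        have h3 : π (C c) = algebraMap R A (C c) := by
          rw [halg, aeval_C]; rfl
        simp [Ψ₀, h2, h3, htmul, Algebra.TensorProduct.algebraMap_apply]
      · intro i
        simp [Ψ₀]
    exact RingHom.congr_fun h1 f
  have hΨker : 𝔍 ≤ RingHom.ker Ψ₀ := by
    rw [h𝔍, sectionIdealOf_le_iff]
    refine ⟨fun f hf => ?_, fun l => ?_, fun j => ?_⟩
    · have h1 : I.map (MvPolynomial.map (algebraMap K F)) ≤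
          (RingHom.ker Ψ₀).comap (rename (Sum.inl : σ → σ ⊕ ι)) := by
        rw [Ideal.map_le_iff_le_comap]
        intro f hf
        rw [Ideal.mem_comap, Ideal.mem_comap, RingHom.mem_ker, hΨ₀, (hker f).2 (hIJ hf), tmul_zero]
      exact h1 hf
    · rw [RingHom.mem_ker, map_sub, map_sub, hΨ₀, ← hy, ← htmul]
      simp [Ψ₀, Algebra.TensorProduct.algebraMap_apply]
    · rw [RingHom.mem_ker, map_sub, map_mul, map_one, hΨ₀, mul_comm,
        show Ψ₀ (X (Sum.inr j)) = s j by simp [Ψ₀], hs, sub_self]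
  let Ψ : (MvPolynomial (σ ⊕ ι) F ⧸ 𝔍) →ₐ[F] F ⊗[R] A := Ideal.Quotient.liftₐ 𝔍 Ψ₀ hΨker
  let γ : MvPolynomial σ K →+* MvPolynomial (σ ⊕ ι) F ⧸ 𝔍 :=
    ((Ideal.Quotient.mk 𝔍).comp (rename (Sum.inl : σ → σ ⊕ ι)).toRingHom).comp
      (MvPolynomial.map (algebraMap K F))
  have hΨγ : ∀ f, Ψ (γ f) = 1 ⊗ₜ[R] π f := hΨ₀
  have hγy : ∀ f : R, γ (aeval y f) = algebraMap R (MvPolynomial (σ ⊕ ι) F ⧸ 𝔍) f := by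
    intro f
    have h1 : γ.comp (aeval y : R →ₐ[K] MvPolynomial σ K).toRingHom =
        algebraMap R (MvPolynomial (σ ⊕ ι) F ⧸ 𝔍) := by
      apply MvPolynomial.ringHom_ext
      · intro c
        have h2 : algebraMap R F (C c) = algebraMap K F c :=
          (IsScalarTower.algebraMap_apply K R F c).symm
        rw [IsScalarTower.algebraMap_apply R F, h2]
        simp [γ, algebraMap_eq]
        rfl
      · intro l
        have h2 := Ideal.Quotient.eq_zero_iff_mem.2 (hL𝔍 l)
        rw [map_sub, map_sub, sub_eq_zero] at h2
        rw [IsScalarTower.algebraMap_apply R F]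
        refine Eq.trans ?_ (h2.symm.trans ?_)
        · simp [γ]
        · rw [rename_C]; rfl
    exact RingHom.congr_fun h1 f
  have hγI : ∀ b ∈ I, γ b = 0 := fun b hb =>
    Ideal.Quotient.eq_zero_iff_mem.2 (hI𝔍 _ (Ideal.mem_map_of_mem _ hb))
  have hγh : ∀ j, Ideal.Quotient.mk 𝔍 (X (Sum.inr j)) * γ (h j) = 1 := by
    intro j
    have h2 := Ideal.Quotient.eq_zero_iff_mem.2 (hh𝔍 j)
    rw [map_sub, map_mul, map_one, sub_eq_zero] at h2
    exact h2.symm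
  -- In the section algebra `f(y)` is a unit because `F` contains its inverse, and the `h j` are
  -- units because of the extra variables. So being killed by `f(y) * (∏ h j) ^ e` means being zero.
  have hγJ : ∀ b ∈ J, γ b = 0 := by
    obtain ⟨f, hf, e, hfe⟩ := hJ
    intro b hb
    have h1 := hγI _ (hfe b hb)
    rw [map_mul, map_mul, map_pow, map_prod, hγy, IsScalarTower.algebraMap_apply R F] at h1
    have h2 : IsUnit (algebraMap F (MvPolynomial (σ ⊕ ι) F ⧸ 𝔍) (algebraMap R F f) *
        (∏ j, γ (h j)) ^ e) := by
      refine ((hF f hf).map _).mul (IsUnit.pow _ ?_)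
      rw [IsUnit.prod_univ_iff]
      exact fun j => IsUnit.of_mul_eq_one_right _ (hγh j)
    exact (h2.mul_right_eq_zero).1 h1
  let β₀ : A →+* MvPolynomial (σ ⊕ ι) F ⧸ 𝔍 := RingHom.liftOfSurjective π.toRingHom hπ
    ⟨γ, fun b hb => hγJ b ((hker b).1 hb)⟩
  have hβ₀ : ∀ f, β₀ (π f) = γ f := fun f =>
    RingHom.liftOfRightInverse_comp_apply π.toRingHom _ _ _ f
  let β : A →ₐ[R] MvPolynomial (σ ⊕ ι) F ⧸ 𝔍 :=
    { toRingHom := β₀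
      commutes' := fun f => by
        change β₀ (algebraMap R A f) = _
        rw [halg, hβ₀, hγy] }
  let Φ : F ⊗[R] A →ₐ[F] MvPolynomial (σ ⊕ ι) F ⧸ 𝔍 :=
    Algebra.TensorProduct.lift (Algebra.ofId F _) β (fun _ _ => Commute.all _ _)
  have hΦ : ∀ f, Φ (1 ⊗ₜ[R] π f) = γ f := by
    intro f
    rw [Algebra.TensorProduct.lift_tmul, map_one, one_mul]
    exact hβ₀ f
  refine ⟨AlgEquiv.ofAlgHom Ψ Φ ?_ ?_⟩
  · ext a
    obtain ⟨f, rfl⟩ := hπ a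
    exact (congrArg Ψ (hΦ f)).trans (hΨγ f)
  · apply Ideal.Quotient.algHom_ext
    apply MvPolynomial.algHom_ext
    rintro (i | j)
    · change Φ (Ψ₀ (X (Sum.inl i))) = Ideal.Quotient.mk 𝔍 (X (Sum.inl i))
      rw [show Ψ₀ (X (Sum.inl i)) = 1 ⊗ₜ[R] π (X i) by simp [Ψ₀], hΦ]
      simp [γ]
    · change Φ (Ψ₀ (X (Sum.inr j))) = Ideal.Quotient.mk 𝔍 (X (Sum.inr j))
      rw [show Ψ₀ (X (Sum.inr j)) = s j by simp [Ψ₀]]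
      have h1 := congrArg Φ (hs j)
      rw [map_mul, map_one, hΦ] at h1
      exact (left_inv_eq_right_inv (hγh j) h1).symm

lemma finrank_tensor_eq {R F M : Type*} [CommRing R] [IsDomain R] [Field F] [Algebra R F]
    [IsFractionRing R F] [AddCommGroup M] [Module R M] :
    Module.finrank F (F ⊗[R] M) = Module.finrank R M := by
  rw [IsFractionRing.finrank_right_eq R F]
  exact IsLocalizedModule.finrank_eq (nonZeroDivisors R) (TensorProduct.mk R F M 1) le_rfl

/-- The base change of a quotient of a polynomial ring. -/
lemma nonempty_algEquiv_tensor_quotient {S F : Type*} [CommRing S] [CommRing F] [Algebra S F]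
    (𝔞 : Ideal (MvPolynomial σ S)) :
    Nonempty (F ⊗[S] (MvPolynomial σ S ⧸ 𝔞) ≃ₐ[F]
      MvPolynomial σ F ⧸ 𝔞.map (MvPolynomial.map (algebraMap S F))) := by
  refine ⟨(Algebra.TensorProduct.tensorQuotientEquiv (R := S) F _ F 𝔞).trans
    (Ideal.quotientEquivAlg _ _ (algebraTensorAlgEquiv S F) ?_)⟩
  refine Eq.trans ?_ (Ideal.map_map (Algebra.TensorProduct.includeRight :
    MvPolynomial σ S →ₐ[S] F ⊗[S] MvPolynomial σ S).toRingHom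
    (algebraTensorAlgEquiv S F).toRingEquiv.toRingHom).symm
  congr 1
  apply MvPolynomial.ringHom_ext
  · intro c
    simp
  · intro i
    simp

end Section

/-! ### Degree as the rank of a generic projection -/

section Degree

variable {k K : Type*} [Field k] [Field K] [Algebra k K] {n μ : ℕ}

lemma linSpan_neg {σ B : Type*} [CommRing B] [Algebra K B] (v : σ → B) :
    linSpan K (fun i => -v i) = linSpan K v := by
  refine le_antisymm (linSpan_le (Submodule.one_le.1 (one_le_linSpan v)) fun i =>
    Submodule.neg_mem _ (mem_linSpan v i))
    (linSpan_le (Submodule.one_le.1 (one_le_linSpan _)) fun i => ?_)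
  simpa using Submodule.neg_mem _ (mem_linSpan (k := K) (fun i => -v i) i)

/-- For the unit ideal `affineDim` is `0`, not μ, but the Hilbert function vanishes and both
normalizations have limit `0`. -/
lemma affineDegree_eq_of_tendsto {J : Ideal (MvPolynomial (Fin n) k)}
    (hJ : J = ⊤ ∨ ringKrullDim (MvPolynomial (Fin n) k ⧸ J) = (μ : WithBot ℕ∞)) {N : ℕ}
    (hN : Filter.Tendsto (fun t : ℕ => (μ.factorial : ℝ) * (affineHilbertFunction J t : ℝ) /
      (t : ℝ) ^ μ) Filter.atTop (nhds (N : ℝ))) : affineDegree J = N := by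
  rw [affineDegree]
  rcases hJ with rfl | hJ
  · have h0 : ∀ t, affineHilbertFunction (⊤ : Ideal (MvPolynomial (Fin n) k)) t = 0 := fun t => by
      rw [affineHilbertFunction_eq]
      exact Module.finrank_zero_of_subsingleton
    simp only [h0, Nat.cast_zero, mul_zero, zero_div] at hN ⊢
    exact hN.limUnder_eq
  · have h1 : affineDim J = μ := by
      rw [affineDim, hJ]
      rfl
    rw [h1]
    exact hN.limUnder_eq

lemma finrank_linSpan_pow_eq_affineHilbertFunction {A : Type*} [CommRing A] [Algebra K A]
    {J : Ideal (MvPolynomial (Fin n) K)} (π : MvPolynomial (Fin n) K →ₐ[K] A)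
    (hπ : Function.Surjective π) (hker : ∀ b, π b = 0 ↔ b ∈ J) (t : ℕ) :
    Module.finrank K (linSpan K (fun i => π (X i)) ^ t : Submodule K A) =
      affineHilbertFunction J t := by
  obtain rfl : RingHom.ker π = J := Ideal.ext hker
  let e := Ideal.quotientKerAlgEquivOfSurjective hπ
  have h := map_linSpan (k := K) e.toAlgHom
    (fun i => (Ideal.Quotient.mk (RingHom.ker π) (X i) : MvPolynomial (Fin n) K ⧸ RingHom.ker π))
  have h1 : (fun i => e.toAlgHom (Ideal.Quotient.mk (RingHom.ker π) (X i))) =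
      fun i => π (X i) := rfl
  rw [h1] at h
  rw [← h, ← Submodule.map_pow, affineHilbertFunction_eq]
  exact LinearEquiv.finrank_map_eq e.toLinearEquiv _

/-- The degree of `J` is the degree of a generic linear projection. -/
theorem finite_and_affineDegree_eq {J : Ideal (MvPolynomial (Fin n) k)}
    (hJ : J = ⊤ ∨ ringKrullDim (MvPolynomial (Fin n) k ⧸ J) = (μ : WithBot ℕ∞))
    {u : Fin μ × Fin n → K} (hu : AlgebraicIndependent k u) {A : Type*} [CommRing A] [Algebra K A]
    [Algebra (MvPolynomial (Fin μ) K) A] [IsScalarTower K (MvPolynomial (Fin μ) K) A]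
    (π : MvPolynomial (Fin n) K →ₐ[K] A) (hπ : Function.Surjective π)
    (hker : ∀ b, π b = 0 ↔ b ∈ extIdeal K J)
    (hy : ∀ l, algebraMap (MvPolynomial (Fin μ) K) A (X l) = -∑ i, u (l, i) • π (X i)) :
    Module.Finite (MvPolynomial (Fin μ) K) A ∧
      affineDegree J = Module.finrank (MvPolynomial (Fin μ) K) A := by
  let _ : Algebra k A := ((algebraMap K A).comp (algebraMap k K)).toAlgebra
  have : IsScalarTower k K A := IsScalarTower.of_algebraMap_eq fun _ => rfl
  set x : Fin n → A := fun i => π (X i) with hx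
  set V := linSpan K x with hV
  have hd : ringKrullDim (MvPolynomial (Fin n) k ⧸ J) ≤ (μ : WithBot ℕ∞) := by
    rcases hJ with rfl | hJ
    · rw [ringKrullDim_eq_bot_of_subsingleton]
      exact bot_le
    · exact hJ.le
  obtain ⟨C, hC⟩ := affineHilbertFunction_le_of_ringKrullDim_le J hd
  -- An upper bound suffices here, so it is enough that `k[x] / J` maps onto the `k`-algebra
  -- generated by the `x i`.
  have hC' : ∀ t, Module.finrank k (linSpan k x ^ t : Submodule k A) ≤ C * (t + 1) ^ μ := by
    intro t
    have hlift : ∀ a ∈ J, (aeval x : MvPolynomial (Fin n) k →ₐ[k] A) a = 0 := by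
      intro a ha
      have h1 : (aeval x : MvPolynomial (Fin n) k →ₐ[k] A).toRingHom =
          π.toRingHom.comp (MvPolynomial.map (algebraMap k K)) := by
        apply MvPolynomial.ringHom_ext
        · intro c
          rw [RingHom.comp_apply, map_C]
          refine (aeval_C x c).trans ?_
          exact (π.commutes (algebraMap k K c)).symm
        · intro i
          simp [hx]
      refine (RingHom.congr_fun h1 a).trans ((hker _).2 ?_)
      exact Ideal.mem_map_of_mem _ ha
    have h2 := map_linSpan (Ideal.Quotient.liftₐ J _ hlift)
      (fun i => (Ideal.Quotient.mk J (X i) : MvPolynomial (Fin n) k ⧸ J))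
    have h3 : (fun i => Ideal.Quotient.liftₐ J _ hlift (Ideal.Quotient.mk J (X i))) = x := by
      funext i
      exact aeval_X x i
    rw [h3] at h2
    rw [← h2, ← Submodule.map_pow]
    refine (Submodule.finrank_map_le _ _).trans ?_
    rw [← affineHilbertFunction_eq]
    exact hC t
  obtain ⟨e, he⟩ := exists_linSpan_pow_le_of_algebraicIndependent (K := K) x hC' hu
  have hgen : ∀ a : A, ∃ t, a ∈ V ^ t := by
    intro a
    obtain ⟨p, rfl⟩ := hπ a
    refine ⟨p.totalDegree, ?_⟩
    have h := aeval_mem_linSpan_pow (k := K) x (le_refl p.totalDegree)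
    rwa [show aeval x = π from (aeval_unique π).symm] at h
  have hVe : ∀ t, V ^ (e + t) ≤
      linSpan K (fun l => algebraMap (MvPolynomial (Fin μ) K) A (X l)) ^ t * V ^ e := by
    simp only [hy]
    rw [linSpan_neg]
    exact he
  have hY : ∀ l, algebraMap (MvPolynomial (Fin μ) K) A (X l) ∈ V := by
    intro l
    rw [hy]
    exact Submodule.neg_mem _ (Submodule.sum_mem _ fun i _ =>
      Submodule.smul_mem _ _ (mem_linSpan x i))
  refine ⟨finite_of_pow_le hgen (one_le_linSpan x) hVe, affineDegree_eq_of_tendsto hJ ?_⟩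
  have h := tendsto_finrank_pow hgen (one_le_linSpan x) hY hVe
  refine h.congr fun t => ?_
  rw [← affineHilbertFunction_extIdeal (K := K),
    finrank_linSpan_pow_eq_affineHilbertFunction π hπ hker]

end Degree

universe u v

/-! ### The generic section and its specialization -/

section Main

open TensorProduct

variable {k : Type*} {E : Type u} [Field k] [Field E] [Algebra k E] {n : ℕ}
  {I : Ideal (MvPolynomial (Fin n) E)} (D : EquidimDecomp I) (r : Fin D.m → ℕ)
  (g : ∀ j, Fin (r j) → MvPolynomial (Fin n) E) (μ : ℕ)

/-- The section ideal with indeterminate coefficients. -/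
def genericSectionIdeal :
    Ideal (MvPolynomial (Fin n ⊕ D.Above μ) (MvPolynomial (ParamIndex D r μ) E)) :=
  sectionIdealOf (I.map (MvPolynomial.map C))
    (fun l : Fin μ => C (X (Sum.inl (l, none))) + ∑ i, C (X (Sum.inl (l, some i))) * X i)
    (fun j => ∑ s : Fin (r j.1), C (X (Sum.inr ⟨j, s⟩)) * MvPolynomial.map C (g j.1 s))

lemma map_genericSectionIdeal {F : Type*} [CommRing F]
    (φ : MvPolynomial (ParamIndex D r μ) E →+* F) :
    (genericSectionIdeal D r g μ).map (MvPolynomial.map φ) =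
      sectionIdealOf (I.map (MvPolynomial.map (φ.comp C)))
        (fun l : Fin μ => C (φ (X (Sum.inl (l, none)))) +
          ∑ i, C (φ (X (Sum.inl (l, some i)))) * X i)
        (fun j => ∑ s : Fin (r j.1), C (φ (X (Sum.inr ⟨j, s⟩))) *
          MvPolynomial.map (φ.comp C) (g j.1 s)) := by
  rw [genericSectionIdeal, map_sectionIdealOf, Ideal.map_map]
  congr 1
  · congr 1
    exact RingHom.ext fun f => MvPolynomial.map_map _ _ f
  · funext l
    simp only [map_add, map_sum, map_mul, map_C, map_X]
  · funext j
    simp only [map_sum, map_mul, map_C, MvPolynomial.map_map]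

lemma map_eval_genericSectionIdeal (c : ParamIndex D r μ → E) :
    (genericSectionIdeal D r g μ).map (MvPolynomial.map (eval c)) = sectionIdeal D r g μ c := by
  rw [map_genericSectionIdeal]
  have h : (eval c).comp C = RingHom.id E := RingHom.ext fun a => eval_C a
  simp only [h, eval_X, MvPolynomial.map_id]
  rw [show MvPolynomial.map (RingHom.id E) = RingHom.id (MvPolynomial (Fin n) E) from
    RingHom.ext fun f => map_id f, Ideal.map_id]
  rfl

lemma exists_field_algebraicIndependent (E : Type u) (τ : Type v) [Field E] :
    ∃ (K : Type (max u v)) (_ : Field K) (_ : Algebra E K) (c : τ → K), AlgebraicIndependent E c :=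
  ⟨FractionRing (MvPolynomial τ E), inferInstance, inferInstance,
    fun i => algebraMap (MvPolynomial τ E) _ (X i),
    (MvPolynomial.algebraicIndependent_X τ E).map'
      (f := IsScalarTower.toAlgHom E (MvPolynomial τ E) (FractionRing (MvPolynomial τ E)))
      (IsFractionRing.injective _ _)⟩

/-- The generic section is finite, of length the degree of the isolated part. -/
theorem finite_and_finrank_genericSection [IsAlgClosed E] {I : Ideal (MvPolynomial (Fin n) k)}
    {t : Finset (Ideal (MvPolynomial (Fin n) k))} (ht : IsPrimaryDecomp I t)
    (D : EquidimDecomp (extIdeal E I)) {r : Fin D.m → ℕ}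
    {g : ∀ j, Fin (r j) → MvPolynomial (Fin n) E}
    (hg : ∀ j, Ideal.span (Set.range (g j)) = D.K j) (μ : ℕ) :
    ∃ (F : Type u) (_ : Field F) (_ : Algebra (MvPolynomial (ParamIndex D r μ) E) F),
      FaithfulSMul (MvPolynomial (ParamIndex D r μ) E) F ∧
      Module.Finite F (F ⊗[MvPolynomial (ParamIndex D r μ) E]
        (MvPolynomial (Fin n ⊕ D.Above μ) (MvPolynomial (ParamIndex D r μ) E) ⧸
          genericSectionIdeal D r g μ)) ∧
      affineDegree (isolatedPart I t μ) =
        Module.finrank F (F ⊗[MvPolynomial (ParamIndex D r μ) E]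
          (MvPolynomial (Fin n ⊕ D.Above μ) (MvPolynomial (ParamIndex D r μ) E) ⧸
            genericSectionIdeal D r g μ)) := by
  -- The constant terms of the `L_l` are left out: they become the variables of `R`.
  obtain ⟨K, _, _, c, hc⟩ := exists_field_algebraicIndependent E
    ((Fin μ × Fin n) ⊕ (Σ j : D.Above μ, Fin (r j.1)))
  let _ : Algebra k K := ((algebraMap E K).comp (algebraMap k E)).toAlgebra
  have : IsScalarTower k E K := IsScalarTower.of_algebraMap_eq fun _ => rfl
  set J := isolatedPart I t μ with hJ
  let R := MvPolynomial (Fin μ) K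
  let F := FractionRing R
  let u : Fin μ × Fin n → K := fun p => c (Sum.inl p)
  let y : Fin μ → MvPolynomial (Fin n) K := fun l => -∑ i, C (u (l, i)) * X i
  let h : D.Above μ → MvPolynomial (Fin n) K := fun j =>
    ∑ s, C (c (Sum.inr ⟨j, s⟩)) * MvPolynomial.map (algebraMap E K) (g j.1 s)
  obtain ⟨A, _, _, π, hπ, hker⟩ : ∃ (A : Type _) (_ : CommRing A) (_ : Algebra K A)
      (π : MvPolynomial (Fin n) K →ₐ[K] A), Function.Surjective π ∧
        ∀ b, π b = 0 ↔ b ∈ extIdeal K J :=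
    ⟨MvPolynomial (Fin n) K ⧸ extIdeal K J, inferInstance, inferInstance,
      Ideal.Quotient.mkₐ K _, Ideal.Quotient.mkₐ_surjective K _,
      fun _ => Ideal.Quotient.eq_zero_iff_mem⟩
  let _ : Algebra R A := (π.comp (aeval y)).toRingHom.toAlgebra
  have hRA : ∀ f : R, algebraMap R A f = π (aeval y f) := fun _ => rfl
  have : IsScalarTower K R A := IsScalarTower.of_algebraMap_eq fun a => by
    rw [hRA]
    exact ((π.comp (aeval y)).commutes a).symm
  obtain ⟨hfin, hdeg⟩ := finite_and_affineDegree_eq (K := K) (u := u)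
    (isolatedPart_eq_top_or_ringKrullDim_eq I t μ)
    ((hc.comp _ Sum.inl_injective).restrictScalars (algebraMap k E).injective) π hπ hker
    (fun l => by
      rw [hRA, aeval_X, map_neg, map_sum]
      simp only [← smul_eq_C_mul, map_smul])
  have hH : ∀ P : Ideal (MvPolynomial (Fin n) K), P.IsPrime →
      ∀ j : D.Above μ, extIdeal K (D.K j) ≤ P → ∏ j, h j ∈ P := by
    intro P _ j hj
    refine Ideal.mem_of_dvd _ (Finset.dvd_prod_of_mem h (Finset.mem_univ j)) ?_
    refine Ideal.sum_mem _ fun s _ => Ideal.mul_mem_left _ _ (hj (Ideal.mem_map_of_mem _ ?_))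
    rw [← hg]
    exact Ideal.subset_span ⟨s, rfl⟩
  obtain ⟨e₁⟩ := nonempty_algEquiv_sectionIdealOf (F := F) (I := extIdeal K I)
    (Ideal.map_mono (le_sInf fun q hq => ht.le hq.1)) (y := y) (h := h) π hπ hker
    (fun l => by rw [hRA, aeval_X]) (exists_aeval_mul_mem D ht y hH)
    (fun j => exists_aeval_mem_sup_span D y j (hg j)
      (hc.comp _ (Sum.inr_injective.comp sigma_mk_injective)))
  -- the coefficients of the generic section
  let v : ParamIndex D r μ → F := Sum.elim
    (fun p => p.2.elim (algebraMap R F (X p.1)) fun i => algebraMap K F (u (p.1, i)))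
    (fun s => algebraMap K F (c (Sum.inr s)))
  have hv : AlgebraicIndependent E v := by
    have h1 : AlgebraicIndependent K fun l => algebraMap R F (X l) :=
      (MvPolynomial.algebraicIndependent_X (Fin μ) K).map' (f := IsScalarTower.toAlgHom K R F)
        (IsFractionRing.injective R F)
    have h2 := (hc.sumElim_comp h1).comp
      (Sum.elim (fun p => p.2.elim (Sum.inl p.1) fun i => Sum.inr (Sum.inl (p.1, i)))
        (fun s => Sum.inr (Sum.inr s)) : ParamIndex D r μ → _) (by
          rintro (⟨l, _ | i⟩ | s) (⟨l', _ | i'⟩ | s') h <;> simp_all)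
    convert h2 using 1
    funext p
    rcases p with ⟨l, _ | i⟩ | s <;> rfl
  let S := MvPolynomial (ParamIndex D r μ) E
  let _ : Algebra S F := (aeval v : S →ₐ[E] F).toRingHom.toAlgebra
  have hSF : algebraMap S F = (aeval v : S →ₐ[E] F).toRingHom := rfl
  have hS : FaithfulSMul S F := by
    rw [faithfulSMul_iff_algebraMap_injective]
    exact hv
  obtain ⟨e₂⟩ := nonempty_algEquiv_tensor_quotient (S := S) (F := F) (genericSectionIdeal D r g μ)
  have hEF : (algebraMap S F).comp C = algebraMap E F := RingHom.ext fun a => by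
    rw [hSF]
    exact aeval_C v a
  have hideal : (genericSectionIdeal D r g μ).map (MvPolynomial.map (algebraMap S F)) =
      sectionIdealOf ((extIdeal K I).map (MvPolynomial.map (algebraMap K F)))
        (fun l : Fin μ => C (algebraMap R F (X l)) - MvPolynomial.map (algebraMap K F) (y l))
        (fun j => MvPolynomial.map (algebraMap K F) (h j)) := by
    have hX : ∀ p, algebraMap S F (X p) = v p := fun p => aeval_X v p
    rw [map_genericSectionIdeal, hEF]
    congr 1
    · rw [extIdeal, extIdeal, Ideal.map_map, Ideal.map_map]
      congr 1
      apply RingHom.ext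
      intro f
      rw [RingHom.comp_apply, RingHom.comp_apply, map_map_algebraMap (E := K),
        MvPolynomial.map_map]
      congr 1
    · funext l
      simp only [hX, y, map_neg, map_sum, map_mul, map_C, map_X, sub_neg_eq_add]
      rfl
    · funext j
      simp only [hX, h, map_sum, map_mul, map_C, map_map_algebraMap]
      rfl
  let e := (e₂.trans (Ideal.quotientEquivAlgOfEq F hideal)).trans e₁
  have hfinF : Module.Finite F (F ⊗[R] A) := inferInstance
  refine ⟨F, inferInstance, inferInstance, hS, Module.Finite.equiv e.symm.toLinearEquiv, ?_⟩
  rw [hdeg, ← finrank_tensor_eq (F := F), e.toLinearEquiv.finrank_eq]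

theorem holdsGenerically_finite_and_finrank_eq_affineDegree [IsAlgClosed E]
    {I : Ideal (MvPolynomial (Fin n) k)} {t : Finset (Ideal (MvPolynomial (Fin n) k))}
    (ht : IsPrimaryDecomp I t) (D : EquidimDecomp (extIdeal E I)) {r : Fin D.m → ℕ}
    {g : ∀ j, Fin (r j) → MvPolynomial (Fin n) E}
    (hg : ∀ j, Ideal.span (Set.range (g j)) = D.K j) (μ : ℕ) :
    HoldsGenerically fun c : ParamIndex D r μ → E =>
      Module.Finite E (MvPolynomial (Fin n ⊕ D.Above μ) E ⧸ sectionIdeal D r g μ c) ∧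
      (Module.finrank E (MvPolynomial (Fin n ⊕ D.Above μ) E ⧸ sectionIdeal D r g μ c) : ℝ) =
        affineDegree (isolatedPart I t μ) := by
  obtain ⟨F, _, _, hS, hfin, hdeg⟩ := finite_and_finrank_genericSection ht D hg μ
  obtain ⟨s, hs, h⟩ := exists_ne_zero_forall_finrank_tensor
    (S := MvPolynomial (ParamIndex D r μ) E)
    (B := MvPolynomial (Fin n ⊕ D.Above μ) (MvPolynomial (ParamIndex D r μ) E) ⧸
      genericSectionIdeal D r g μ) F
  -- The parameter ring is itself the polynomial ring, so `s` is the required polynomial and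
  -- specialization at `c` is base change along `eval c`.
  refine ⟨s, hs, fun c hc => ?_⟩
  let _ : Algebra (MvPolynomial (ParamIndex D r μ) E) E := (eval c).toAlgebra
  obtain ⟨h1, h2⟩ := h E hc
  obtain ⟨e₁⟩ := nonempty_algEquiv_tensor_quotient (F := E) (genericSectionIdeal D r g μ)
  let e := e₁.trans (Ideal.quotientEquivAlgOfEq E (map_eval_genericSectionIdeal D r g μ c))
  refine ⟨Module.Finite.equiv e.toLinearEquiv, ?_⟩
  rw [hdeg, ← h2, e.toLinearEquiv.finrank_eq]

end Main
end

theorem mainTheorem9 {n : ℕ} (I : Ideal (MvPolynomial (Fin n) ℚ))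
    (t : Finset (Ideal (MvPolynomial (Fin n) ℚ))) (ht : IsPrimaryDecomp I t)
    (D : EquidimDecomp (I.map (MvPolynomial.map (algebraMap ℚ ℂ))))
    (r : Fin D.m → ℕ) (g : ∀ j, Fin (r j) → MvPolynomial (Fin n) ℂ)
    (hg : ∀ j, Ideal.span (Set.range (g j)) = D.K j) (μ : ℕ) :
    HoldsGenerically fun c : ParamIndex D r μ → ℂ =>
      Module.Finite ℂ
        (MvPolynomial (Fin n ⊕ D.Above μ) ℂ ⧸ sectionIdeal D r g μ c) ∧
      (Module.finrank ℂ
        (MvPolynomial (Fin n ⊕ D.Above μ) ℂ ⧸ sectionIdeal D r g μ c) : ℝ) =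
        affineDegree (isolatedPart I t μ) :=
  holdsGenerically_finite_and_finrank_eq_affineDegree ht D hg μ
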